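/- **Setting.** $\mathbb X$ and $\mathbb A$ are Borel (standard Borel) spaces; $\mathcal P(\cdot)$ denotes the Borel space of Borel probability measures on a Borel space; $q(dy\mid x,a)$ is a Borel measurable transition kernel from $\mathbb X\times\mathbb A$ to $\mathbb X$; for each $x$ there is a nonempty set $A(x)\subset\mathbb A$ of admissible actions, and $\{(x,a): a\in A(x)\}$ is analytic. Put $\Omega=(\mathbb X\times\mathbb A)^\infty$ and $h_n=(x_0,a_0,\dots,x_{n-1},a_{n-1},x_n)$. A policy $\pi=(\mu_n)_{n\ge0}$ is a sequence of universally measurable stochastic kernels $\mu_n(da_n\mid h_n)$ with $\mu_n(A(x_n)\mid h_n)=1$ for all $h_n$; it is nonrandomized if every $\mu_n(\cdot\mid h_n)$ is a Dirac measure. $\Pi$ is the set of all policies; $\Pi_m$ (Markov) and $\Pi_{sm}$ (semi-Markov) are the sets of policies for which each $\mu_n(da_n\mid h_n)$ depends only on $x_n$, respectively only on $(x_0,x_n)$; $\Pi_s$ (stationary) and $\Pi_{ss}$ (semi-stationary) are those for which, moreover, $\mu_n(da_n\mid h_n)=\mu(da_n\mid x_n)$, respectively $\mu(da_n\mid x_0,x_n)$,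 for all $n$, with one universally measurable kernel $\mu$. Let $\rho_{p_0}[\pi]\in\mathcal P(\Omega)$ be the law of $(x_0,a_0,x_1,a_1,\dots)$ under $\pi$ and the initial distribution $p_0$, and $\rho_x[\pi]=\rho_{\delta_x}[\pi]$. Let $\mathcal S,\mathcal S_m,\mathcal S_s$ be the sets of all $\rho_{p_0}[\pi]$, $p_0\in\mathcal P(\mathbb X)$, with $\pi$ in $\Pi,\Pi_m,\Pi_s$ respectively, and let $\mathcal S',\mathcal S'_m,\mathcal S'_s$ be the subsets obtained from the nonrandomized policies of these classes. With $p_0(p)$ the distribution of $x_0$ under $p$, put $\tilde{\mathcal S}_\star=\{(x,p): p\in\mathcal S_\star,\ p_0(p)=\delta_x\}$, with sections $\tilde{\mathcal S}_\star(x)$, and define $\tilde{\mathcal S}'_\star$, $\tilde{\mathcal S}'_\star(x)$ in the same way from $\mathcal S'_\star$. A function $f$ from an analytic set $D$ to $[-\infty,\infty]$ is lower semianalytic if $\{f\le r\}$ is analytic for all real $r$. **Mixtures.** Let $\bar\lambda$ be the countable product of Lebesgue measures on $[0,1]$. A *mixture representation* of a policy $\pi$ is a family $\bar f(\bar\theta)$,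 $\bar\theta\in[0,1]^\infty$, of nonrandomized policies such that $(p_0,\bar\theta)\mapsto\rho_{p_0}[\bar f(\bar\theta)]$ is universally measurable, $\rho_{p_0}[\pi](E)=\int\rho_{p_0}[\bar f(\bar\theta)](E)\,\bar\lambda(d\bar\theta)$ for all $p_0\in\mathcal P(\mathbb X)$ and all universally measurable $E\subset\Omega$, and all $\bar f(\bar\theta)$ are Markov (semi-Markov) if $\pi$ is. **Theorem.** Let $(\mathcal S_\star,\Pi_\star)$ be $(\mathcal S,\Pi)$, $(\mathcal S_m,\Pi_{sm})$ or $(\mathcal S_s,\Pi_{ss})$, and let $\phi:\tilde{\mathcal S}_\star\to[-\infty,\infty]$ be lower semianalytic. (i) The function $\phi^*(x)=\inf_{p\in\tilde{\mathcal S}_\star(x)}\phi(x,p)$, $x\in\mathbb X$, is lower semianalytic. (ii) Let $E^*$ be the set of all $x$ for which $\phi(x,\cdot)$ has a minimizer over $\tilde{\mathcal S}_\star(x)$. For each $\epsilon>0$ there is a policy $\pi^*\in\Pi_\star$ such that $\rho_x[\pi^*]\in\tilde{\mathcal S}_\star(x)$ for all $x\in\mathbb X$, $$\phi(x,\rho_x[\pi^*])=\phi^*(x)\quad\text{for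 } x\in E^*,$$ and, for $x\notin E^*$, $\phi(x,\rho_x[\pi^*])\le\phi^*(x)+\epsilon$ if $\phi^*(x)>-\infty$ and $\phi(x,\rho_x[\pi^*])\le-1/\epsilon$ if $\phi^*(x)=-\infty$. (iii) Suppose that $\phi^*(x)=\inf_{p\in\tilde{\mathcal S}'_\star(x)}\phi(x,p)$ for all $x\in\mathbb X$, and let $E'$ be the set of all $x$ for which $\phi(x,\cdot)$ has a minimizer over $\tilde{\mathcal S}'_\star(x)$. Then for each $\epsilon>0$ there is a nonrandomized policy $\pi^*\in\Pi_\star$ such that $\rho_x[\pi^*]\in\tilde{\mathcal S}'_\star(x)$ for all $x\in\mathbb X$ and the relations in (ii) hold with $E'$ in place of $E^*$. If $\mathcal S_\star$ is $\mathcal S$ or $\mathcal S_m$, the supposition holds whenever each $\pi\in\Pi$ or $\pi\in\Pi_m$, respectively, has a mixture representation $\bar f$ with $$\phi(x,\rho_x[\pi])\ \ge\ \int_{[0,1]^\infty}\phi\big(x,\rho_x[\bar f(\bar\theta)]\big)\,\bar\lambda(d\bar\theta)\qquad\text{for all }x\in\mathbb X$$ (the integral is the integral of the positive part minus that of the negative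 part, with $\infty-\infty=\infty$); in that case, moreover, every $x\in E^*$ with $\phi^*(x)>-\infty$ belongs to $E'$. -/

import Mathlib

open MeasureTheory ProbabilityTheory Set

open scoped ENNReal

noncomputable section

namespace UMDP

/-! ### Universal measurability, analytic sets, lower semianalytic functions

A Borel space is a measurable space with `[StandardBorelSpace X]`.  The space `P(X)` of probability
measures is `ProbabilityMeasure X`; its `σ`-algebra is the one generated by the evaluations
`p ↦ p B`, which for a Borel space `X` is the Borel `σ`-algebra of the weak topology. -/

/-- The universal `σ`-algebra: the intersection, over all probability measures `p`, of the
completions of the given `σ`-algebra with respect to `p`. -/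
@[reducible] def universalSigma (X : Type*) [m : MeasurableSpace X] : MeasurableSpace X :=
  ⨅ p : ProbabilityMeasure X, eventuallyMeasurableSpace m (ae (p : Measure X))

/-- Universally measurable functions. -/
def UnivMeasurable {X Y : Type*} [MeasurableSpace X] [mY : MeasurableSpace Y] (f : X → Y) : Prop :=
  @Measurable X Y (universalSigma X) mY f

/-- Universally measurable stochastic kernels on `Y` given `X`. -/
def IsUnivKernel {X Y : Type*} [MeasurableSpace X] [MeasurableSpace Y]
    (k : X → ProbabilityMeasure Y) : Prop :=
  ∀ B : Set Y, MeasurableSet B → UnivMeasurable fun x => (k x : Measure Y) B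

/-- Analytic sets: images of Borel spaces under Borel measurable maps.  (The domain may be empty.
A Borel subset of a Polish space is the same thing as a standard Borel space, and up to isomorphism
all of these live in `Type`.) -/
def IsAnalytic {X : Type*} [MeasurableSpace X] (s : Set X) : Prop :=
  ∃ (Y : Type) (_ : MeasurableSpace Y) (_ : StandardBorelSpace Y) (f : Y → X),
    Measurable f ∧ range f = s

/-- All sublevel sets `{x ∈ D | f x ≤ r}`, `r` real, are analytic. -/
def HasAnalyticSublevels {X : Type*} [MeasurableSpace X] (D : Set X) (f : X → EReal) : Prop :=
  ∀ r : ℝ, IsAnalytic {x | x ∈ D ∧ f x ≤ (r : EReal)}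

/-- `f` is lower semianalytic on `D`; only the values of `f` on `D` matter. -/
def LowerSemianalyticOn {X : Type*} [MeasurableSpace X] (D : Set X) (f : X → EReal) : Prop :=
  IsAnalytic D ∧ HasAnalyticSublevels D f

/-- The integral `∫ f⁺ dμ - ∫ f⁻ dμ` of an extended-real function, with `∞ - ∞ = ∞`.
For a function that is measurable for the completion of `μ`, the Lebesgue integrals used here are
the integrals with respect to that completion. -/
def extIntegral {T : Type*} [MeasurableSpace T] (μ : Measure T) (f : T → EReal) : EReal :=
  open Classical in
  if ∫⁻ t, (f t).toENNReal ∂μ = ⊤ then ⊤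
  else ((∫⁻ t, (f t).toENNReal ∂μ : ℝ≥0∞) : EReal) - ((∫⁻ t, (-f t).toENNReal ∂μ : ℝ≥0∞) : EReal)

/-! ### The control model, histories and policies -/

/-- The space `(X × A)^∞` of trajectories `(x₀, a₀, x₁, a₁, …)`. -/
abbrev Traj (X A : Type*) := ℕ → X × A

/-- The space `(X × A)^n × X` of histories `(x₀, a₀, …, x_{n-1}, a_{n-1}, x_n)`. -/
abbrev Hist (X A : Type*) (n : ℕ) := (Fin n → X × A) × X

/-- The history `h_n` of a trajectory. -/
def histAt {X A : Type*} (n : ℕ) (ω : Traj X A) : Hist X A n := (fun i => ω i, (ω n).1)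

/-- The vector `h'_n = (x₀, a₀, …, x_n, a_n)` of a trajectory. -/
def pathAt {X A : Type*} (n : ℕ) (ω : Traj X A) : Fin (n + 1) → X × A := fun i => ω i

/-- The initial state `x₀` of a history. -/
def Hist.first {X A : Type*} : {n : ℕ} → Hist X A n → X
  | 0, h => h.2
  | _ + 1, h => (h.1 0).1

/-- The current state `x_n` of a history. -/
def Hist.last {X A : Type*} {n : ℕ} (h : Hist X A n) : X := h.2

/-- A Markov decision process: nonempty admissible action sets `A(x)` with analytic graph, and a
Borel measurable transition kernel. -/
structure MDP (X A : Type*) [MeasurableSpace X] [MeasurableSpace A] where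
  /-- the set `A(x)` of admissible actions at `x` -/
  adm : X → Set A
  adm_nonempty : ∀ x, (adm x).Nonempty
  adm_analytic : IsAnalytic {z : X × A | z.2 ∈ adm z.1}
  /-- the state transition kernel -/
  q : Kernel (X × A) X
  q_markov : IsMarkovKernel q

attribute [instance] MDP.q_markov

variable {X A : Type*} [MeasurableSpace X] [MeasurableSpace A]

/-- Universally measurable (randomized, history-dependent) policies. -/
structure Policy (M : MDP X A) where
  /-- the kernel `μ_n(da_n | h_n)` -/
  kernel : ∀ n, Hist X A n → ProbabilityMeasure A
  univ_kernel : ∀ n, IsUnivKernel (kernel n)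
  constraint : ∀ n (h : Hist X A n), (kernel n h : Measure A) (M.adm h.last) = 1

namespace Policy

variable {M : MDP X A}

/-- `μ_n(da_n | h_n)` is a function of `x_n`. -/
def IsMarkov (π : Policy M) : Prop :=
  ∀ n, ∃ ν : X → ProbabilityMeasure A, ∀ h : Hist X A n, π.kernel n h = ν h.last

/-- `μ_n(da_n | h_n)` is a function of `(x₀, x_n)`. -/
def IsSemiMarkov (π : Policy M) : Prop :=
  ∀ n, ∃ ν : X × X → ProbabilityMeasure A, ∀ h : Hist X A n, π.kernel n h = ν (h.first, h.last)

/-- Markov, with the same kernel at every stage. -/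
def IsStationary (π : Policy M) : Prop :=
  ∃ ν : X → ProbabilityMeasure A, IsUnivKernel ν ∧
    ∀ n (h : Hist X A n), π.kernel n h = ν h.last

/-- Semi-Markov, with the same kernel `ν(da | x₀, x_n)` at every stage. -/
def IsSemiStationary (π : Policy M) : Prop :=
  ∃ ν : X × X → ProbabilityMeasure A, IsUnivKernel ν ∧
    ∀ n (h : Hist X A n), π.kernel n h = ν (h.first, h.last)

/-- All the measures `μ_n(da_n | h_n)` are Dirac measures. -/
def IsNonrandomized (π : Policy M) : Prop :=
  ∀ n (h : Hist X A n), ∃ a : A, π.kernel n h = diracProba a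

end Policy

/-! ### Strategic measures -/

/-- `p` is the law of the trajectory when the initial distribution is `p₀`, actions are drawn from
the policy `π` and states from the transition kernel. -/
structure IsInducedBy {M : MDP X A} (π : Policy M) (p₀ : ProbabilityMeasure X)
    (p : ProbabilityMeasure (Traj X A)) : Prop where
  initial : ∀ B : Set X, MeasurableSet B →
    (p : Measure (Traj X A)) {ω | (ω 0).1 ∈ B} = (p₀ : Measure X) B
  action : ∀ (n : ℕ) (C : Set (Hist X A n)) (B : Set A), MeasurableSet C → MeasurableSet B →
    (p : Measure (Traj X A)) {ω | histAt n ω ∈ C ∧ (ω n).2 ∈ B} =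
      ∫⁻ ω in {ω | histAt n ω ∈ C}, (π.kernel n (histAt n ω) : Measure A) B ∂(p : Measure _)
  transition : ∀ (n : ℕ) (C : Set (Fin (n + 1) → X × A)) (B : Set X),
    MeasurableSet C → MeasurableSet B →
    (p : Measure (Traj X A)) {ω | pathAt n ω ∈ C ∧ (ω (n + 1)).1 ∈ B} =
      ∫⁻ ω in {ω | pathAt n ω ∈ C}, M.q (ω n) B ∂(p : Measure _)

@[fun_prop]
lemma measurable_histAt (n : ℕ) : Measurable (histAt n : Traj X A → Hist X A n) := by
  unfold histAt; fun_prop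

@[fun_prop]
lemma measurable_pathAt (n : ℕ) : Measurable (pathAt n : Traj X A → Fin (n + 1) → X × A) := by
  unfold pathAt; fun_prop

lemma UnivMeasurable.nullMeasurable {H Y : Type*} [MeasurableSpace H] [MeasurableSpace Y]
    {f : H → Y} (hf : UnivMeasurable f) (m : Measure H) [hm : IsProbabilityMeasure m] :
    NullMeasurable f m := fun s hs => by
  have h := hf hs
  have hle : universalSigma H ≤ eventuallyMeasurableSpace _ (ae m) :=
    iInf_le (fun p : ProbabilityMeasure H => eventuallyMeasurableSpace _ (ae (p : Measure H)))
      ⟨m, hm⟩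
  exact hle _ h

lemma UnivMeasurable.comp_measurable {G H Y : Type*} [MeasurableSpace G] [MeasurableSpace H]
    [MeasurableSpace Y] {f : H → Y} (hf : UnivMeasurable f) {g : G → H} (hg : Measurable g) :
    UnivMeasurable (f ∘ g) := fun s hs => by
  have h := MeasurableSpace.measurableSet_iInf.1 (hf hs)
  refine MeasurableSpace.measurableSet_iInf.2 fun p => ?_
  have : IsProbabilityMeasure ((p : Measure G).map g) :=
    Measure.isProbabilityMeasure_map hg.aemeasurable
  obtain ⟨t, ht, hst⟩ := h ⟨(p : Measure G).map g, this⟩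
  exact ⟨g ⁻¹' t, hg ht, (Measure.tendsto_ae_map hg.aemeasurable).eventually hst⟩

/-- A universally measurable kernel agrees almost everywhere with a Borel measurable one. -/
lemma exists_kernel_version {H : Type*} [MeasurableSpace H] [StandardBorelSpace A] [Nonempty A]
    (m : Measure H) [IsProbabilityMeasure m] {k : H → ProbabilityMeasure A} (hk : IsUnivKernel k) :
    ∃ η : Kernel H A, IsMarkovKernel η ∧
      ∀ B, MeasurableSet B → (fun h => η h B) =ᵐ[m] fun h => (k h : Measure A) B := by
  have hN : ∀ B, MeasurableSet B → NullMeasurable (fun h => (k h : Measure A) B) m :=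
    fun B hB => (hk B hB).nullMeasurable m
  let κ : Kernel (NullMeasurableSpace H m) A :=
    ⟨fun h => (k h : Measure A),
      Measure.measurable_of_measurable_coe _ fun B hB => (hN B hB).measurable'⟩
  have hκ : IsMarkovKernel κ := ⟨fun h => (k h).2⟩
  have hc : IsProbabilityMeasure m.completion :=
    ⟨(Measure.completion_apply m univ).trans measure_univ⟩
  let i : NullMeasurableSpace H m → H := fun x => x
  have hi : Measurable i := fun s hs => hs.nullMeasurableSet
  have hmi : m.completion.map i = m := by
    ext s hs
    rw [Measure.map_apply hi hs]
    exact Measure.completion_apply m s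
  let J : Measure (H × A) := (m.completion ⊗ₘ κ).map (Prod.map i id)
  have hij : Measurable (Prod.map i (id : A → A)) := hi.prodMap measurable_id
  have hJ : IsProbabilityMeasure J := Measure.isProbabilityMeasure_map hij.aemeasurable
  have hJp : ∀ C B, MeasurableSet C → MeasurableSet B →
      J (C ×ˢ B) = ∫⁻ h in C, (k h : Measure A) B ∂m := by
    intro C B hC hB
    have h1 : J (C ×ˢ B) = ∫⁻ h in i ⁻¹' C, κ h B ∂m.completion := by
      rw [← Measure.compProd_apply_prod (hi hC) hB, Measure.map_apply hij (hC.prod hB)]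
      rfl
    obtain ⟨g, hg, hgk⟩ := (hN B hB).aemeasurable
    have hgk' : (fun h => κ h B) =ᵐ[m.completion] fun h => g (i h) := hgk
    rw [h1, lintegral_congr_ae (ae_restrict_of_ae hgk'), lintegral_congr_ae (ae_restrict_of_ae hgk)]
    conv_rhs => rw [← hmi]
    rw [setLIntegral_map hC hg hi]
  have hfst : J.fst = m := by
    ext s hs
    rw [Measure.fst_apply hs, ← prod_univ, hJp s univ hs MeasurableSet.univ]
    simp
  refine ⟨J.condKernel, inferInstance, fun B hB => ?_⟩
  refine ae_eq_of_forall_setLIntegral_eq_of_sigmaFinite₀ (Kernel.measurable_coe _ hB).aemeasurable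
    (hN B hB).aemeasurable fun C hC _ => ?_
  rw [← hJp C B hC hB]
  conv_rhs => rw [← J.disintegrate J.condKernel]
  rw [Measure.compProd_apply_prod hC hB, hfst]

/-- One transition followed by one action, for a given law of the past. -/
lemma exists_step {Z : Type*} [MeasurableSpace Z] [StandardBorelSpace A] [Nonempty A]
    (m : Measure Z) [IsProbabilityMeasure m] (q : Kernel Z X) [IsMarkovKernel q]
    {k : Z × X → ProbabilityMeasure A} (hk : IsUnivKernel k) :
    ∃ κ : Kernel Z (X × A), IsMarkovKernel κ ∧
      (∀ C D, MeasurableSet C → MeasurableSet D →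
        (m ⊗ₘ κ) {w | w.1 ∈ C ∧ w.2.1 ∈ D} = ∫⁻ z in C, q z D ∂m) ∧
      ∀ C B, MeasurableSet C → MeasurableSet B →
        (m ⊗ₘ κ) {w | (w.1, w.2.1) ∈ C ∧ w.2.2 ∈ B} =
          ∫⁻ w in {w | (w.1, w.2.1) ∈ C}, (k (w.1, w.2.1) : Measure A) B ∂(m ⊗ₘ κ) := by
  obtain ⟨η, hη, hηk⟩ := exists_kernel_version (m ⊗ₘ q) hk
  have hassoc : (m ⊗ₘ q) ⊗ₘ η = (m ⊗ₘ (q ⊗ₖ η)).map MeasurableEquiv.prodAssoc.symm :=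
    Measure.compProd_assoc.symm
  refine ⟨q ⊗ₖ η, inferInstance, fun C D hC hD => ?_, fun C B hC hB => ?_⟩
  · have : {w : Z × X × A | w.1 ∈ C ∧ w.2.1 ∈ D} = C ×ˢ (D ×ˢ univ) := by ext; simp
    rw [this, Measure.compProd_apply_prod hC (hD.prod MeasurableSet.univ)]
    refine lintegral_congr fun z => ?_
    rw [Kernel.compProd_apply_prod hD MeasurableSet.univ]
    simp
  · let e : Z × X × A → Z × X := fun w => (w.1, w.2.1)
    have he : Measurable e := by fun_prop
    have hfst : (m ⊗ₘ (q ⊗ₖ η)).map e = m ⊗ₘ q := by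
      conv_rhs => rw [← Measure.fst_compProd (m ⊗ₘ q) η, hassoc, Measure.fst,
        Measure.map_map measurable_fst (MeasurableEquiv.measurable _)]
      rfl
    have h1 : (m ⊗ₘ (q ⊗ₖ η)) {w | e w ∈ C ∧ w.2.2 ∈ B} = ((m ⊗ₘ q) ⊗ₘ η) (C ×ˢ B) := by
      rw [hassoc, Measure.map_apply (MeasurableEquiv.measurable _) (hC.prod hB)]
      rfl
    have h2 := hηk B hB
    rw [← hfst] at h2
    have h3 := ae_of_ae_map he.aemeasurable h2
    change (m ⊗ₘ (q ⊗ₖ η)) {w | e w ∈ C ∧ w.2.2 ∈ B} =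
      ∫⁻ w in e ⁻¹' C, (k (e w) : Measure A) B ∂(m ⊗ₘ (q ⊗ₖ η))
    rw [h1, Measure.compProd_apply_prod hC hB, ← hfst,
      setLIntegral_map hC (Kernel.measurable_coe _ hB) he]
    exact lintegral_congr_ae (ae_restrict_of_ae h3)

lemma UnivMeasurable.setLIntegral_map {Z Y : Type*} [MeasurableSpace Z] [MeasurableSpace Y]
    {f : Y → ℝ≥0∞} (hf : UnivMeasurable f) (μ : Measure Z) [IsProbabilityMeasure μ] {g : Z → Y}
    (hg : Measurable g) {s : Set Y} (hs : MeasurableSet s) :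
    ∫⁻ y in s, f y ∂(μ.map g) = ∫⁻ z in g ⁻¹' s, f (g z) ∂μ := by
  have : IsProbabilityMeasure (μ.map g) := Measure.isProbabilityMeasure_map hg.aemeasurable
  have h := (hf.nullMeasurable (μ.map g)).aemeasurable
  have h' := h.restrict (s := s)
  rw [Measure.restrict_map hg hs] at h' ⊢
  exact lintegral_map' h' hg.aemeasurable

/-- Every policy and initial distribution determine a law on the trajectory space. -/
lemma exists_isInducedBy [StandardBorelSpace A] {M : MDP X A} (π : Policy M)
    (p₀ : ProbabilityMeasure X) : ∃ p, IsInducedBy π p₀ p := by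
  have hX : Nonempty X := (p₀ : Measure X).nonempty_of_neZero
  have hA : Nonempty A := let x := hX.some; ⟨(M.adm_nonempty x).some⟩
  -- the law of the first state and action
  have he0 : Measurable fun x : X => ((fun i : Fin 0 => i.elim0, x) : Hist X A 0) := by fun_prop
  obtain ⟨η0, hη0, hη0k⟩ := exists_kernel_version (p₀ : Measure X)
    (k := fun x => π.kernel 0 ((fun i : Fin 0 => i.elim0, x) : Hist X A 0))
    fun B hB => (π.univ_kernel 0 B hB).comp_measurable he0
  let m0 : Measure (X × A) := (p₀ : Measure X) ⊗ₘ η0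
  -- the kernels of the later stages
  let Z : ℕ → Type _ := fun n => (i : Finset.Iic n) → X × A
  let e : ∀ n, Z n × X → Hist X A (n + 1) := fun n w =>
    (fun i => w.1 ⟨i, Finset.mem_Iic.2 (Nat.lt_succ_iff.1 i.2)⟩, w.2)
  have he : ∀ n, Measurable (e n) := fun n => by
    refine Measurable.prodMk (measurable_pi_lambda _ fun i => ?_) measurable_snd
    exact (measurable_pi_apply _).comp measurable_fst
  let qn : ∀ n, Kernel (Z n) X := fun n =>
    M.q.comap (fun z : Z n => z ⟨n, Finset.mem_Iic.2 le_rfl⟩) (measurable_pi_apply _)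
  have step : ∀ n (m : {m : Measure (Z n) // IsProbabilityMeasure m}),
      ∃ κ : {κ : Kernel (Z n) (X × A) // IsMarkovKernel κ},
      (∀ C D, MeasurableSet C → MeasurableSet D →
        (m.1 ⊗ₘ κ.1) {w | w.1 ∈ C ∧ w.2.1 ∈ D} = ∫⁻ z in C, qn n z D ∂m.1) ∧
      ∀ C B, MeasurableSet C → MeasurableSet B →
        (m.1 ⊗ₘ κ.1) {w | (w.1, w.2.1) ∈ C ∧ w.2.2 ∈ B} =
          ∫⁻ w in {w | (w.1, w.2.1) ∈ C},
            (π.kernel (n + 1) (e n (w.1, w.2.1)) : Measure A) B ∂(m.1 ⊗ₘ κ.1) := by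
    rintro n ⟨m, hm⟩
    obtain ⟨κ, hκ, h⟩ := exists_step m (qn n) (k := fun w => π.kernel (n + 1) (e n w))
      fun B hB => (π.univ_kernel (n + 1) B hB).comp_measurable (he n)
    exact ⟨⟨κ, hκ⟩, h⟩
  choose K hK using step
  let glue : ∀ n, Z n × (X × A) → Z (n + 1) := fun n w i =>
    if h : i.1 ≤ n then w.1 ⟨i.1, Finset.mem_Iic.2 h⟩ else w.2
  have hglue : ∀ n, Measurable (glue n) := fun n => by
    refine measurable_pi_lambda _ fun i => ?_
    by_cases h : i.1 ≤ n
    · simp only [glue, h, dite_true]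
      exact (measurable_pi_apply _).comp measurable_fst
    · simpa only [glue, h, dite_false] using measurable_snd
  let seq : ∀ n, {m : Measure (Z n) // IsProbabilityMeasure m} := fun n => Nat.rec
    ⟨m0.map (MeasurableEquiv.piUnique (fun _ : Finset.Iic 0 => X × A)).symm,
      Measure.isProbabilityMeasure_map (MeasurableEquiv.measurable _).aemeasurable⟩
    (fun n m => ⟨(m.1 ⊗ₘ (K n m).1).map (glue n), by
      have := m.2
      have := (K n m).2
      exact Measure.isProbabilityMeasure_map (hglue n).aemeasurable⟩) n
  let κ : ∀ n, Kernel (Z n) (X × A) := fun n => (K n (seq n)).1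
  have hκ : ∀ n, IsMarkovKernel (κ n) := fun n => (K n (seq n)).2
  let P : Measure (Traj X A) := Kernel.trajMeasure (X := fun _ => X × A) m0 κ
  have hP : IsProbabilityMeasure P := by infer_instance
  let r : ∀ n, Traj X A → Z n := fun n => Preorder.frestrictLe (π := fun _ => X × A) n
  have hr : ∀ n, Measurable (r n) := fun n => by fun_prop
  have hlaw' : ∀ n, P.map (r n) ⊗ₘ κ n = P.map (fun x => (r n x, x (n + 1))) := fun n =>
    Kernel.map_frestrictLe_trajMeasure_compProd_eq_map_trajMeasure
  have hseq : ∀ n, P.map (r n) = (seq n).1 := by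
    intro n
    induction n with
    | zero =>
      change Measure.map (r 0) (Kernel.traj κ 0 ∘ₘ _) = _
      rw [Measure.map_comp _ _ (hr 0), Kernel.traj_map_frestrictLe, Kernel.partialTraj_self,
        Measure.id_comp]
      rfl
    | succ n ih =>
      have h1 : (seq (n + 1)).1 = ((seq n).1 ⊗ₘ κ n).map (glue n) := rfl
      rw [h1, ← ih, hlaw', Measure.map_map (hglue n) (by fun_prop)]
      congr 1
      funext x i
      by_cases h : i.1 ≤ n
      · simp [glue, h, r, Preorder.frestrictLe]
      · have : i.1 = n + 1 := le_antisymm (Finset.mem_Iic.1 i.2) (by omega)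
        simp [glue, r, Preorder.frestrictLe, this]
  have hlaw : ∀ n, (seq n).1 ⊗ₘ κ n = P.map (fun x => (r n x, x (n + 1))) := fun n => by
    rw [← hseq, hlaw']
  have hlaw0 : P.map (fun x => x 0) = m0 := by
    have h1 : (fun x : Traj X A => x 0) =
      (MeasurableEquiv.piUnique (fun _ : Finset.Iic 0 => X × A)) ∘ r 0 := rfl
    rw [h1, ← Measure.map_map (MeasurableEquiv.measurable _) (hr 0), hseq]
    exact MeasurableEquiv.map_map_symm _
  have hev : Measurable fun x : Traj X A => x 0 := measurable_pi_apply 0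
  have hg : ∀ n, Measurable fun x : Traj X A => (r n x, x (n + 1)) := fun n => by fun_prop
  refine ⟨⟨P, hP⟩, ?_, ?_, ?_⟩
  · intro B hB
    have h1 : m0 (B ×ˢ univ) = P {ω | (ω 0).1 ∈ B} := by
      rw [← hlaw0, Measure.map_apply hev (hB.prod MeasurableSet.univ)]
      congr 1
      ext; simp
    refine h1.symm.trans ?_
    rw [Measure.compProd_apply_prod hB MeasurableSet.univ]
    simp
  · intro n C B hC hB
    rcases n with _ | n
    · let g : Traj X A → X := fun ω => (ω 0).1
      have hgm : Measurable g := by fun_prop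
      let C' : Set X := (fun x : X => ((fun i : Fin 0 => i.elim0, x) : Hist X A 0)) ⁻¹' C
      have hC' : MeasurableSet C' := he0 hC
      have hh : ∀ ω : Traj X A, histAt 0 ω = (fun i : Fin 0 => i.elim0, g ω) := fun ω =>
        Prod.ext (funext fun i => i.elim0) rfl
      have hfst : P.map g = (p₀ : Measure X) := by
        have : g = Prod.fst ∘ fun x : Traj X A => x 0 := rfl
        rw [this, ← Measure.map_map measurable_fst hev, hlaw0]
        exact Measure.fst_compProd _ _
      have hae := hη0k B hB
      rw [← hfst] at hae
      have hae' := ae_of_ae_map hgm.aemeasurable hae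
      simp only [hh]
      change P {ω | g ω ∈ C' ∧ (ω 0).2 ∈ B} = ∫⁻ ω in g ⁻¹' C', _ ∂P
      have h1 : m0 (C' ×ˢ B) = P {ω | g ω ∈ C' ∧ (ω 0).2 ∈ B} := by
        rw [← hlaw0, Measure.map_apply hev (hC'.prod hB)]
        rfl
      rw [← h1, Measure.compProd_apply_prod hC' hB, ← hfst,
        setLIntegral_map hC' (Kernel.measurable_coe _ hB) hgm]
      exact lintegral_congr_ae (ae_restrict_of_ae hae')
    · have h := (hK n (seq n)).2 (e n ⁻¹' C) B (he n hC) hB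
      change ((seq n).1 ⊗ₘ κ n) _ = ∫⁻ w in _, _ ∂((seq n).1 ⊗ₘ κ n) at h
      have hproj : Measurable fun w : Z n × X × A => (w.1, w.2.1) := by fun_prop
      have hf : UnivMeasurable fun w : Z n × X × A =>
          (π.kernel (n + 1) (e n (w.1, w.2.1)) : Measure A) B :=
        (π.univ_kernel (n + 1) B hB).comp_measurable ((he n).comp hproj)
      have hCm : MeasurableSet {w : Z n × X × A | (w.1, w.2.1) ∈ e n ⁻¹' C} := hproj (he n hC)
      have hBm : MeasurableSet {w : Z n × X × A | w.2.2 ∈ B} := by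
        have : Measurable fun w : Z n × X × A => w.2.2 := by fun_prop
        exact this hB
      rw [hlaw n, hf.setLIntegral_map P (hg n) hCm] at h
      exact (Measure.map_apply (hg n) (hCm.inter hBm)).symm.trans h
  · intro n C B hC hB
    let c : Z n → (Fin (n + 1) → X × A) :=
      fun z i => z ⟨i, Finset.mem_Iic.2 (Nat.lt_succ_iff.1 i.2)⟩
    have hc : Measurable c := measurable_pi_lambda _ fun i => measurable_pi_apply _
    have h := (hK n (seq n)).1 (c ⁻¹' C) B (hc hC) hB
    change ((seq n).1 ⊗ₘ κ n) _ = _ at h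
    have hCm : MeasurableSet {w : Z n × X × A | w.1 ∈ c ⁻¹' C} := measurable_fst (hc hC)
    have hBm : MeasurableSet {w : Z n × X × A | w.2.1 ∈ B} := by
      have : Measurable fun w : Z n × X × A => w.2.1 := by fun_prop
      exact this hB
    rw [hlaw n, ← hseq n, setLIntegral_map (hc hC) (Kernel.measurable_coe _ hB) (hr n)] at h
    exact (Measure.map_apply (hg n) (hCm.inter hBm)).symm.trans h

/-- Every policy and initial distribution determine at most one law on the trajectory space. -/
lemma IsInducedBy.unique {M : MDP X A} {π : Policy M} {p₀ : ProbabilityMeasure X}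
    {p p' : ProbabilityMeasure (Traj X A)} (hp : IsInducedBy π p₀ p) (hp' : IsInducedBy π p₀ p') :
    p = p' := by
  -- `D n` pairs the current history with the current action
  let D : ∀ n, Traj X A → Hist X A n × A := fun n ω => (histAt n ω, (ω n).2)
  have hD : ∀ n, Measurable (D n) := fun n => by fun_prop
  let E : ∀ n, Traj X A → (Fin (n + 1) → X × A) × X := fun n ω => (pathAt n ω, (ω (n + 1)).1)
  have hE : ∀ n, Measurable (E n) := fun n => by fun_prop
  have prob : ∀ {Y : Type _} [MeasurableSpace Y] (p : ProbabilityMeasure (Traj X A))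
      {g : Traj X A → Y}, Measurable g → IsProbabilityMeasure ((p : Measure (Traj X A)).map g) :=
    fun p _ hg => Measure.isProbabilityMeasure_map hg.aemeasurable
  have hHD : ∀ n, (p : Measure (Traj X A)).map (histAt n) = (p' : Measure (Traj X A)).map (histAt n) →
      (p : Measure (Traj X A)).map (D n) = (p' : Measure (Traj X A)).map (D n) := by
    intro n h
    have := prob p (hD n)
    have := prob p' (hD n)
    have key : ∀ {p : ProbabilityMeasure (Traj X A)}, IsInducedBy π p₀ p →
        ∀ {C : Set (Hist X A n)} {B : Set A}, MeasurableSet C → MeasurableSet B →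
        (p : Measure (Traj X A)).map (D n) (C ×ˢ B) =
          ∫⁻ h in C, (π.kernel n h : Measure A) B ∂((p : Measure (Traj X A)).map (histAt n)) := by
      intro p hp C B hC hB
      rw [Measure.map_apply (hD n) (hC.prod hB), UnivMeasurable.setLIntegral_map
        (π.univ_kernel n B hB) _ (measurable_histAt n) hC]
      exact hp.action n C B hC hB
    refine Measure.ext_prod fun {C B} hC hB => ?_
    rw [key hp hC hB, key hp' hC hB, h]
  have hDE : ∀ n, (p : Measure (Traj X A)).map (pathAt n) = (p' : Measure (Traj X A)).map (pathAt n) →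
      (p : Measure (Traj X A)).map (E n) = (p' : Measure (Traj X A)).map (E n) := by
    intro n h
    have := prob p (hE n)
    have := prob p' (hE n)
    have key : ∀ {p : ProbabilityMeasure (Traj X A)}, IsInducedBy π p₀ p →
        ∀ {C : Set (Fin (n + 1) → X × A)} {B : Set X}, MeasurableSet C → MeasurableSet B →
        (p : Measure (Traj X A)).map (E n) (C ×ˢ B) =
          ∫⁻ h in C, M.q (h (Fin.last n)) B ∂((p : Measure (Traj X A)).map (pathAt n)) := by
      intro p hp C B hC hB
      have hm : Measurable fun h : Fin (n + 1) → X × A => M.q (h (Fin.last n)) B :=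
        (Kernel.measurable_coe M.q hB).comp (measurable_pi_apply _)
      rw [Measure.map_apply (hE n) (hC.prod hB), setLIntegral_map hC hm (measurable_pathAt n)]
      exact hp.transition n C B hC hB
    refine Measure.ext_prod fun {C B} hC hB => ?_
    rw [key hp hC hB, key hp' hC hB, h]
  have hDpath : ∀ n, (p : Measure (Traj X A)).map (D n) = (p' : Measure (Traj X A)).map (D n) →
      (p : Measure (Traj X A)).map (pathAt n) = (p' : Measure (Traj X A)).map (pathAt n) := by
    intro n h
    let g : Hist X A n × A → (Fin (n + 1) → X × A) := fun w i =>
      if h : i.1 < n then w.1.1 ⟨i, h⟩ else (w.1.2, w.2)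
    have hg : Measurable g := by
      refine measurable_pi_lambda _ fun i => ?_
      by_cases h : i.1 < n
      · simp only [g, h, dite_true]; fun_prop
      · simp only [g, h, dite_false]; fun_prop
    have hpath : (pathAt n : Traj X A → Fin (n + 1) → X × A) = g ∘ D n := by
      funext ω i
      by_cases h : i.1 < n
      · simp [g, D, h, pathAt, histAt]
      · have : i.1 = n := by omega
        simp [g, D, pathAt, histAt, this]
    rw [hpath, ← Measure.map_map hg (hD n), ← Measure.map_map hg (hD n), h]
  have hH : ∀ n, (p : Measure (Traj X A)).map (histAt n) = (p' : Measure (Traj X A)).map (histAt n) := by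
    intro n
    induction n with
    | zero =>
      let e0 : X → Hist X A 0 := fun x => (fun i : Fin 0 => i.elim0, x)
      have he0 : Measurable e0 := by fun_prop
      have hx : Measurable fun ω : Traj X A => (ω 0).1 := by fun_prop
      have hh : (histAt 0 : Traj X A → Hist X A 0) = e0 ∘ fun ω => (ω 0).1 :=
        funext fun ω => Prod.ext (funext fun i => i.elim0) rfl
      have h0 : (p : Measure (Traj X A)).map (fun ω => (ω 0).1) =
          (p' : Measure (Traj X A)).map (fun ω => (ω 0).1) := by
        ext B hB
        rw [Measure.map_apply hx hB, Measure.map_apply hx hB]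
        exact (hp.initial B hB).trans (hp'.initial B hB).symm
      rw [hh, ← Measure.map_map he0 hx, ← Measure.map_map he0 hx, h0]
    | succ n ih => exact hDE n (hDpath n (hHD n ih))
  have hpath : ∀ n, (p : Measure (Traj X A)).map (pathAt n) = (p' : Measure (Traj X A)).map (pathAt n) :=
    fun n => hDpath n (hHD n (hH n))
  have hproj : ∀ p : ProbabilityMeasure (Traj X A), IsProjectiveLimit (p : Measure (Traj X A))
      fun I : Finset ℕ => (p : Measure (Traj X A)).map I.restrict := fun p I => rfl
  have hfin : ∀ J : Finset ℕ, (p : Measure (Traj X A)).map J.restrict =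
      (p' : Measure (Traj X A)).map J.restrict := by
    intro J
    obtain ⟨N, hN⟩ := J.exists_le
    let g : (Fin (N + 1) → X × A) → (J → X × A) :=
      fun w i => w ⟨i, Nat.lt_succ_iff.2 (hN i i.2)⟩
    have hg : Measurable g := measurable_pi_lambda _ fun i => measurable_pi_apply _
    have hJ : (J.restrict : Traj X A → (i : J) → X × A) = g ∘ pathAt N := rfl
    rw [hJ, ← Measure.map_map hg (measurable_pathAt N),
      ← Measure.map_map hg (measurable_pathAt N), hpath N]
  exact Subtype.ext ((hproj p).unique fun J => (hfin J).symm)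

/-- The strategic measure `ρ_{p₀}[π]`: the law of the trajectory under `π` from `p₀`. -/
def strategicMeasure [StandardBorelSpace A] {M : MDP X A} (p₀ : ProbabilityMeasure X)
    (π : Policy M) : ProbabilityMeasure (Traj X A) :=
  (exists_isInducedBy π p₀).choose

lemma strategicMeasure_eq_iff [StandardBorelSpace A] {M : MDP X A} {p₀ : ProbabilityMeasure X}
    {π : Policy M} {p : ProbabilityMeasure (Traj X A)} :
    p = strategicMeasure p₀ π ↔ IsInducedBy π p₀ p :=
  ⟨fun h => h ▸ (exists_isInducedBy π p₀).choose_spec,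
    fun h => h.unique (exists_isInducedBy π p₀).choose_spec⟩

/-- The three cases `(S, Π)`, `(S_m, Π_sm)`, `(S_s, Π_ss)`. -/
inductive PolicyClass
  | general
  | markov
  | stationary

/-- The policies generating the strategic measures: `Π`, `Π_m`, `Π_s` respectively. -/
def PolicyClass.generators (c : PolicyClass) (M : MDP X A) : Set (Policy M) :=
  match c with
  | general => univ
  | markov => {π | π.IsMarkov}
  | stationary => {π | π.IsStationary}

/-- The policies among which optimal ones are sought: `Π`, `Π_sm`, `Π_ss` respectively. -/
def PolicyClass.policies (c : PolicyClass) (M : MDP X A) : Set (Policy M) :=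
  match c with
  | general => univ
  | markov => {π | π.IsSemiMarkov}
  | stationary => {π | π.IsSemiStationary}

/-- The set of strategic measures of the policies in `Q`, over all initial distributions. -/
def strategicSet [StandardBorelSpace A] {M : MDP X A} (Q : Set (Policy M)) :
    Set (ProbabilityMeasure (Traj X A)) :=
  {p | ∃ π ∈ Q, ∃ p₀ : ProbabilityMeasure X, p = strategicMeasure p₀ π}

/-- The pairs `(x, p)` with `p` in the given set and with initial distribution `δ_x` under `p`. -/
def withInitialState (S : Set (ProbabilityMeasure (Traj X A))) :
    Set (X × ProbabilityMeasure (Traj X A)) :=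
  {z | z.2 ∈ S ∧ (z.2 : Measure (Traj X A)).map (fun ω => (ω 0).1) = Measure.dirac z.1}

/-- The set `{(x, p) : p ∈ S_⋆, p₀(p) = δ_x}`. -/
def PolicyClass.graph [StandardBorelSpace A] (c : PolicyClass) (M : MDP X A) :
    Set (X × ProbabilityMeasure (Traj X A)) :=
  withInitialState (strategicSet (c.generators M))

/-- The set `{(x, p) : p ∈ S'_⋆, p₀(p) = δ_x}`, for the nonrandomized policies only. -/
def PolicyClass.graphNonrand [StandardBorelSpace A] (c : PolicyClass) (M : MDP X A) :
    Set (X × ProbabilityMeasure (Traj X A)) :=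
  withInitialState (strategicSet (c.generators M ∩ {π | π.IsNonrandomized}))

/-! ### Partial minimization -/

/-- The value `inf {φ (x, y) | (x, y) ∈ D}`. -/
def partialInf {V Y : Type*} (D : Set (V × Y)) (φ : V × Y → EReal) (x : V) : EReal :=
  ⨅ (y : Y) (_ : (x, y) ∈ D), φ (x, y)

/-- The points `x` at which `φ (x, ·)` has a minimizer over the section of `D`. -/
def minimizerSet {V Y : Type*} (D : Set (V × Y)) (φ : V × Y → EReal) : Set V :=
  {x | ∃ y, (x, y) ∈ D ∧ ∀ y', (x, y') ∈ D → φ (x, y) ≤ φ (x, y')}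

/-- `φ (x, ζ x)` equals `v x` on `E`, and off `E` it is at most `v x + ε`
(at most `-1/ε` where `v x = -∞`). -/
def IsEpsOptimal {V Y : Type*} (φ : V × Y → EReal) (v : V → EReal) (E : Set V) (ε : ℝ)
    (ζ : V → Y) : Prop :=
  (∀ x ∈ E, φ (x, ζ x) = v x) ∧
    ∀ x ∉ E, (v x ≠ ⊥ → φ (x, ζ x) ≤ v x + (ε : EReal)) ∧
      (v x = ⊥ → φ (x, ζ x) ≤ ((-1 / ε : ℝ) : EReal))

/-! ### Mixtures of nonrandomized policies -/

/-- The countable product of Lebesgue measures on `[0,1]^∞`. -/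
def lebesgueProd : Measure (ℕ → unitInterval) := Measure.infinitePi fun _ => volume

/-- The nonrandomized policies `f θ`, `θ ∈ [0,1]^∞`, represent `π` as a mixture: the strategic
measure of `π` is the average of those of the `f θ`, for every initial distribution. -/
structure IsMixtureOf [StandardBorelSpace A] {M : MDP X A} (π : Policy M)
    (f : (ℕ → unitInterval) → Policy M) : Prop where
  nonrandomized : ∀ θ, (f θ).IsNonrandomized
  univ_measurable : UnivMeasurable fun z : ProbabilityMeasure X × (ℕ → unitInterval) =>
    strategicMeasure z.1 (f z.2)
  mixture : ∀ (p₀ : ProbabilityMeasure X) (E : Set (Traj X A)),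
    MeasurableSet[universalSigma (Traj X A)] E →
    (strategicMeasure p₀ π : Measure (Traj X A)) E =
      ∫⁻ θ, (strategicMeasure p₀ (f θ) : Measure (Traj X A)) E ∂lebesgueProd
  markov : π.IsMarkov → ∀ θ, (f θ).IsMarkov
  semiMarkov : π.IsSemiMarkov → ∀ θ, (f θ).IsSemiMarkov

end UMDP

end

/-! ### The space of probability measures is standard Borel -/

/-! The problem is turned into partial minimization over an analytic set in the Borel space of pairs
(initial state, law on trajectories), followed by measurable selection and by the recovery of one
policy from the selected laws.

The key point is that a policy can be read off from its strategic measure `p`. The three classes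
differ only in the statistic on which actions depend: the whole history, the stage with the state,
or the state alone. Drawing the stage at random with positive weights yields an occupation measure
of statistic and action; its disintegration `Statistic.cond` is jointly Borel in `p` and the
statistic, and under a policy acting on that statistic it agrees almost surely, at every stage, with
the policy. Hence the existential "some policy generates `p`" becomes a list of conditions on `p`
(`Statistic.feasible_eq`): the initial law is a point mass, states follow `q`, actions follow
`cond`, and `cond` is almost surely admissible. All are Borel except the last, which is analytic
because the measures carried by an analytic set form an analytic set
(`IsAnalytic.setOf_measure_eq_one`). Nonrandomized policies fit the same scheme, by requiring in
addition that `cond` lie in the Borel set of Dirac measures.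

Projections of analytic sets are analytic, which gives (i). The Jankov–von Neumann theorem, applied
to the epigraph of the cost, gives a universally measurable choice `ζ x` of strategic measures that
is exact where the infimum is attained (`exists_univMeasurable_isEpsOptimal`). The policy using
`cond (ζ x₀, ·)`, corrected where inadmissible, generates `ζ x` from every `x`
(`Statistic.exists_policy_of_selector`); its dependence on `x₀` is why semi-Markov and
semi-stationary policies appear. For the mixture criterion, an average is at least the infimum of
its terms, and an average not exceeding a real number `r` has a term not exceeding `r`. -/

lemma MeasurableEquiv.standardBorelSpace {P Y : Type*} [MeasurableSpace P] [MeasurableSpace Y]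
    [StandardBorelSpace Y] (e : P ≃ᵐ Y) : StandardBorelSpace P := by
  let := upgradeStandardBorel Y
  let τ : TopologicalSpace P := TopologicalSpace.induced e inferInstance
  have h : IsHomeomorph e :=
    isHomeomorph_iff_isEmbedding_surjective.2
      ⟨⟨⟨rfl⟩, e.injective⟩, e.surjective⟩
  refine ⟨τ, ⟨?_⟩, h.isClosedEmbedding.polishSpace⟩
  rw [← e.measurableEmbedding.comap_eq, borel_comap]
  exact congrArg _ (eq_borel_upgradeStandardBorel Y)

/-- A measurable retract of a standard Borel space is standard Borel. -/
lemma StandardBorelSpace.of_retract {P Y : Type*} [MeasurableSpace P] [MeasurableSpace Y]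
    [StandardBorelSpace Y] {D : P → Y} {R : Y → P} (hD : Measurable D) (hR : Measurable R)
    (h : ∀ p, R (D p) = p) : StandardBorelSpace P := by
  have hS : MeasurableSet {y | D (R y) = y} := measurableSet_eq_fun (hD.comp hR) measurable_id
  have := hS.standardBorel
  let F : P → {y | D (R y) = y} := fun p => ⟨D p, congrArg D (h p)⟩
  have hF : Measurable F := hD.subtype_mk
  let e : P ≃ᵐ {y | D (R y) = y} :=
    { toFun := F
      invFun := fun y => R y
      left_inv := h
      right_inv := fun y => Subtype.ext y.2
      measurable_toFun := hF
      measurable_invFun := hR.comp measurable_subtype_coe }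
  exact e.standardBorelSpace

namespace MeasureTheory.ProbabilityMeasure

lemma measurable_of_measurable_coe {Ω Y : Type*} [MeasurableSpace Ω] [MeasurableSpace Y]
    {f : Ω → ProbabilityMeasure Y}
    (h : ∀ B, MeasurableSet B → Measurable fun ω => (f ω : Measure Y) B) : Measurable f :=
  (Measure.measurable_of_measurable_coe _ h).subtype_mk

lemma measurable_coe {Y : Type*} [MeasurableSpace Y] {B : Set Y} (hB : MeasurableSet B) :
    Measurable fun p : ProbabilityMeasure Y => (p : Measure Y) B :=
  (Measure.measurable_coe hB).comp measurable_subtype_coe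

lemma isRatStieltjesPoint_cdf (μ : Measure ℝ) :
    IsRatStieltjesPoint (id : (ℚ → ℝ) → ℚ → ℝ) fun q => cdf μ q where
  mono := fun q r h => monotone_cdf μ (by exact_mod_cast h)
  tendsto_atTop_one :=
    (tendsto_cdf_atTop μ).comp (tendsto_ratCast_atTop_iff.2 Filter.tendsto_id)
  tendsto_atBot_zero :=
    (tendsto_cdf_atBot μ).comp (tendsto_ratCast_atBot_iff.2 Filter.tendsto_id)
  iInf_rat_gt_eq := fun t => by
    rw [id, ← (cdf μ).iInf_rat_gt_eq]
    refine Equiv.iInf_congr (Equiv.subtypeEquivRight fun q => by simp) fun q => rfl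

/-- Both sides are right-continuous, hence determined by infima over larger rationals. There they
agree because `toRatCDF` leaves a genuine rational cdf unchanged. -/
lemma stieltjesOfMeasurableRat_cdf (μ : Measure ℝ) :
    stieltjesOfMeasurableRat (id : (ℚ → ℝ) → ℚ → ℝ) measurable_id (fun q => cdf μ q) = cdf μ := by
  ext x
  rw [← StieltjesFunction.iInf_rat_gt_eq, ← StieltjesFunction.iInf_rat_gt_eq]
  refine iInf_congr fun q => ?_
  rw [stieltjesOfMeasurableRat_eq, toRatCDF_of_isRatStieltjesPoint (isRatStieltjesPoint_cdf μ), id]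

/-- A law on `Y` is encoded by the rational values of the cdf of its image under an embedding into
`ℝ`. Since `stieltjesOfMeasurableRat` returns a cdf for every function on `ℚ`, decoding is
measurable on the whole of `ℚ → ℝ`, and the laws form a measurable retract of it. -/
instance standardBorelSpace {Y : Type*} [MeasurableSpace Y] [StandardBorelSpace Y] :
    StandardBorelSpace (ProbabilityMeasure Y) := by
  rcases isEmpty_or_nonempty Y with hY | hY
  · have : IsEmpty (ProbabilityMeasure Y) :=
      ⟨fun p => hY.false (p : Measure Y).nonempty_of_neZero.some⟩
    infer_instance
  obtain ⟨e, he⟩ := exists_measurableEmbedding_real Y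
  obtain ⟨g, hg, hge⟩ := he.exists_measurable_extend (g := (id : Y → Y)) measurable_id fun _ => hY
  let D : ProbabilityMeasure Y → ℚ → ℝ := fun p q => cdf ((p : Measure Y).map e) q
  have hprob : ∀ p : ProbabilityMeasure Y, IsProbabilityMeasure ((p : Measure Y).map e) :=
    fun p => Measure.isProbabilityMeasure_map he.measurable.aemeasurable
  have hD : Measurable D := by
    refine measurable_pi_lambda _ fun q => ?_
    have : (fun p => D p q) = fun p : ProbabilityMeasure Y =>
        ((p : Measure Y) (e ⁻¹' Iic (q : ℝ))).toReal := by
      funext p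
      have := hprob p
      simp only [D, cdf_eq_real, Measure.real, Measure.map_apply he.measurable measurableSet_Iic]
    rw [this]
    exact (measurable_coe (he.measurable measurableSet_Iic)).ennreal_toReal
  let R : (ℚ → ℝ) → ProbabilityMeasure Y := fun f =>
    ⟨(stieltjesOfMeasurableRat id measurable_id f).measure.map g,
      Measure.isProbabilityMeasure_map hg.aemeasurable⟩
  have hR : Measurable R :=
    ((Measure.measurable_map g hg).comp
      (measurable_measure_stieltjesOfMeasurableRat measurable_id)).subtype_mk
  refine StandardBorelSpace.of_retract hD hR fun p => Subtype.ext ?_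
  have := hprob p
  change (stieltjesOfMeasurableRat id measurable_id (D p)).measure.map g = _
  rw [stieltjesOfMeasurableRat_cdf, measure_cdf, Measure.map_map hg he.measurable, hge,
    Measure.map_id]
  rfl

end MeasureTheory.ProbabilityMeasure

/-! ### Universal measurability -/

namespace UMDP

variable {X Y Z : Type*} [MeasurableSpace X] [MeasurableSpace Y] [MeasurableSpace Z]

lemma measurableSet_universalSigma {s : Set X} : MeasurableSet[universalSigma X] s ↔
    ∀ p : ProbabilityMeasure X, NullMeasurableSet s (p : Measure X) :=
  MeasurableSpace.measurableSet_iInf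

lemma le_universalSigma : ‹MeasurableSpace X› ≤ universalSigma X := fun _ hs =>
  measurableSet_universalSigma.2 fun _ => hs.nullMeasurableSet

lemma _root_.Measurable.univMeasurable {f : X → Y} (hf : Measurable f) : UnivMeasurable f :=
  hf.mono le_universalSigma le_rfl

/-- A universally measurable map is measurable for the universal `σ`-algebras on both sides. -/
lemma UnivMeasurable.measurable_universalSigma {f : X → Y} (hf : UnivMeasurable f) :
    @Measurable X Y (universalSigma X) (universalSigma Y) f := fun s hs => by
  refine measurableSet_universalSigma.2 fun p => ?_
  let i : NullMeasurableSpace X (p : Measure X) → Y := f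
  have hi : Measurable i := (hf.nullMeasurable (p : Measure X)).measurable'
  have hc : IsProbabilityMeasure (p : Measure X).completion :=
    ⟨(Measure.completion_apply _ univ).trans measure_univ⟩
  obtain ⟨t, ht, hst⟩ := measurableSet_universalSigma.1 hs
    ⟨(p : Measure X).completion.map i, Measure.isProbabilityMeasure_map hi.aemeasurable⟩
  have h : i ⁻¹' s =ᵐ[(p : Measure X).completion] i ⁻¹' t :=
    (Measure.tendsto_ae_map hi.aemeasurable).eventually hst
  have h' : f ⁻¹' s =ᵐ[(p : Measure X)] f ⁻¹' t := h
  exact (hf.nullMeasurable (p : Measure X) ht).congr h'.symm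

lemma UnivMeasurable.comp {g : Y → Z} {f : X → Y} (hg : UnivMeasurable g)
    (hf : UnivMeasurable f) : UnivMeasurable (g ∘ f) :=
  Measurable.comp hg hf.measurable_universalSigma

lemma UnivMeasurable.prodMk {f : X → Y} {g : X → Z} (hf : UnivMeasurable f)
    (hg : UnivMeasurable g) : UnivMeasurable fun x => (f x, g x) :=
  Measurable.prodMk hf hg

lemma UnivMeasurable.ite {p : X → Prop} {_ : DecidablePred p} {f g : X → Y}
    (hp : MeasurableSet[universalSigma X] {x | p x}) (hf : UnivMeasurable f)
    (hg : UnivMeasurable g) : UnivMeasurable fun x => if p x then f x else g x :=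
  Measurable.ite hp hf hg

lemma univMeasurable_from_prod_countable [Countable Z] [MeasurableSingletonClass Z]
    {f : Z × X → Y} (hf : ∀ z, UnivMeasurable fun x => f (z, x)) : UnivMeasurable f := by
  intro s hs
  have h : f ⁻¹' s = ⋃ z, {w : Z × X | w.1 = z} ∩ Prod.snd ⁻¹' ((fun x => f (z, x)) ⁻¹' s) := by
    ext ⟨z, x⟩; simp
  rw [h]
  refine MeasurableSet.iUnion fun z => MeasurableSet.inter ?_ ?_
  · exact le_universalSigma _ (measurable_fst (measurableSet_singleton z))
  · exact measurable_snd.univMeasurable.measurable_universalSigma (hf z hs)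

lemma isUnivKernel_iff {k : X → ProbabilityMeasure Y} : IsUnivKernel k ↔ UnivMeasurable k :=
  ⟨fun h => @ProbabilityMeasure.measurable_of_measurable_coe X Y (universalSigma X) _ k h,
    fun h _ hB => Measurable.comp (ProbabilityMeasure.measurable_coe hB) h⟩

/-! ### Analytic sets -/

/-- `IsAnalytic` asks for a domain in `Type`; a domain from any other universe is replaced by its
Borel image in `ℝ`. -/
lemma isAnalytic_range [StandardBorelSpace Y] {f : Y → X} (hf : Measurable f) :
    IsAnalytic (range f) := by
  obtain ⟨e, he⟩ := exists_measurableEmbedding_real Y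
  have := he.measurableSet_range.standardBorel
  refine ⟨range e, inferInstance, this, f ∘ he.equivRange.symm,
    hf.comp he.equivRange.symm.measurable, ?_⟩
  exact he.equivRange.symm.surjective.range_comp f

lemma IsAnalytic.image {s : Set X} (hs : IsAnalytic s) {f : X → Y} (hf : Measurable f) :
    IsAnalytic (f '' s) := by
  obtain ⟨Z, _, _, g, hg, rfl⟩ := hs
  rw [← range_comp]
  exact isAnalytic_range (hf.comp hg)

lemma _root_.MeasurableSet.isAnalytic [StandardBorelSpace X] {s : Set X} (hs : MeasurableSet s) :
    IsAnalytic s := by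
  have := hs.standardBorel
  simpa using isAnalytic_range (measurable_subtype_coe : Measurable (Subtype.val : s → X))

lemma isAnalytic_iff_analyticSet [TopologicalSpace X] [PolishSpace X] [BorelSpace X]
    {s : Set X} : IsAnalytic s ↔ AnalyticSet s := by
  constructor
  · rintro ⟨Z, _, _, g, hg, rfl⟩
    rw [← image_univ]
    exact MeasurableSet.univ.analyticSet_image hg
  · intro h
    rw [AnalyticSet] at h
    rcases h with rfl | ⟨f, hf, rfl⟩
    · exact MeasurableSet.empty.isAnalytic
    · exact isAnalytic_range hf.measurable

lemma IsAnalytic.iInter [StandardBorelSpace X] {ι : Type*} [Countable ι] {s : ι → Set X}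
    (hs : ∀ i, IsAnalytic (s i)) : IsAnalytic (⋂ i, s i) := by
  rcases isEmpty_or_nonempty ι with h | h
  · simpa using (MeasurableSet.univ : MeasurableSet (univ : Set X)).isAnalytic
  let := upgradeStandardBorel X
  simp only [isAnalytic_iff_analyticSet] at hs ⊢
  exact AnalyticSet.iInter hs

lemma IsAnalytic.iUnion [StandardBorelSpace X] {ι : Type*} [Countable ι] {s : ι → Set X}
    (hs : ∀ i, IsAnalytic (s i)) : IsAnalytic (⋃ i, s i) := by
  let := upgradeStandardBorel X
  simp only [isAnalytic_iff_analyticSet] at hs ⊢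
  exact AnalyticSet.iUnion hs

lemma IsAnalytic.inter [StandardBorelSpace X] {s t : Set X} (hs : IsAnalytic s)
    (ht : IsAnalytic t) : IsAnalytic (s ∩ t) := by
  rw [inter_eq_iInter]
  exact IsAnalytic.iInter fun b => by cases b <;> assumption

lemma IsAnalytic.union [StandardBorelSpace X] {s t : Set X} (hs : IsAnalytic s)
    (ht : IsAnalytic t) : IsAnalytic (s ∪ t) := by
  rw [union_eq_iUnion]
  exact IsAnalytic.iUnion fun b => by cases b <;> assumption

/-- The preimage is the projection of the fibre product of `f` with a parametrization of `s`, and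
the fibre product is Borel. -/
lemma IsAnalytic.preimage [StandardBorelSpace X] [StandardBorelSpace Y] {s : Set Y}
    (hs : IsAnalytic s) {f : X → Y} (hf : Measurable f) : IsAnalytic (f ⁻¹' s) := by
  obtain ⟨Z, _, _, g, hg, rfl⟩ := hs
  have h : MeasurableSet {w : X × Z | f w.1 = g w.2} :=
    measurableSet_eq_fun (hf.comp measurable_fst) (hg.comp measurable_snd)
  convert h.isAnalytic.image measurable_fst using 1
  ext x
  simp [eq_comm]

/-! ### Analytic sets are universally measurable -/

/-- Compactness of the box below `b`. The cylinders are not compact, so counterexamples `x k` are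
truncated into the box; truncation leaves the first `k` coordinates alone, so a limit of truncations
is also a limit of the `x k`. -/
lemma exists_cylinder_subset {U : Set (ℕ → ℕ)} (hU : IsOpen U) {b : ℕ → ℕ}
    (h : ∀ x : ℕ → ℕ, (∀ i, x i ≤ b i) → x ∈ U) :
    ∃ k, ∀ x : ℕ → ℕ, (∀ i < k, x i ≤ b i) → x ∈ U := by
  by_contra! H
  choose x hxb hxU using H
  let y : ℕ → ℕ → ℕ := fun k i => min (x k i) (b i)
  have hK : IsCompact (univ.pi fun i => Iic (b i) : Set (ℕ → ℕ)) :=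
    isCompact_univ_pi fun i => (finite_Iic (b i)).isCompact
  obtain ⟨z, hz, φ, hφ, hlim⟩ := hK.tendsto_subseq (x := y) fun k i _ => mem_Iic.2 (min_le_right _ _)
  have hlim' : Filter.Tendsto (x ∘ φ) Filter.atTop (nhds z) := by
    rw [tendsto_pi_nhds] at hlim ⊢
    intro i
    refine (hlim i).congr' ?_
    filter_upwards [Filter.eventually_gt_atTop i] with k hk
    exact min_eq_left (hxb _ i (hk.trans_le (hφ.id_le k)))
  obtain ⟨k, hk⟩ := (hlim'.eventually (hU.mem_nhds (h z fun i => hz i trivial))).exists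
  exact hxU _ hk

/-- The capacitability argument: the coordinates of Baire space are bounded one at a time, each
bound being large enough to keep the outer measure of the image above `r`. In the limit the domain
is a compact box. -/
lemma exists_isCompact_subset_range [TopologicalSpace X] [PolishSpace X] [BorelSpace X]
    (μ : Measure X) [IsFiniteMeasure μ] {f : (ℕ → ℕ) → X} (hf : Continuous f) {r : ℝ≥0∞}
    (hr : r < μ (range f)) : ∃ K ⊆ range f, IsCompact K ∧ r ≤ μ K := by
  let box : (ℕ → ℕ) → ℕ → Set (ℕ → ℕ) := fun b k => {x | ∀ i < k, x i ≤ b i}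
  have step : ∀ k (b : ℕ → ℕ), r < μ (f '' box b k) →
      ∃ n, r < μ (f '' box (Function.update b k n) (k + 1)) := by
    intro k b hb
    have hU : f '' box b k = ⋃ n, f '' box (Function.update b k n) (k + 1) := by
      rw [← image_iUnion]
      congr 1
      ext x
      simp only [box, mem_ofPred_eq, mem_iUnion]
      constructor
      · intro h
        refine ⟨x k, fun i hi => ?_⟩
        rcases Nat.lt_succ_iff_lt_or_eq.1 hi with hi | rfl
        · simpa [Function.update_of_ne hi.ne] using h i hi
        · simp
      · rintro ⟨n, h⟩ i hi
        simpa [Function.update_of_ne hi.ne] using h i (hi.trans (Nat.lt_succ_self k))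
    have hmono : Monotone fun n => f '' box (Function.update b k n) (k + 1) := by
      refine fun n m hnm => image_mono fun x hx i hi => (hx i hi).trans ?_
      rcases eq_or_ne i k with rfl | h
      · simpa using hnm
      · simp [Function.update_of_ne h]
    -- Continuity from below holds for increasing families of arbitrary sets, so these images need
    -- not be measurable.
    rw [hU, hmono.measure_iUnion] at hb
    exact lt_iSup_iff.1 hb
  choose! N hN using step
  let u : ℕ → ℕ → ℕ := fun k =>
    Nat.rec (fun _ => 0) (fun k b => Function.update b k (N k b)) k
  have hu : ∀ k, r < μ (f '' box (u k) k) := by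
    intro k
    induction k with
    | zero => simpa [box] using hr
    | succ k ih => exact hN k _ ih
  have hstab : ∀ k i, i < k → u k i = u (i + 1) i := by
    intro k i hik
    induction k with
    | zero => omega
    | succ k ih =>
      rcases Nat.lt_succ_iff_lt_or_eq.1 hik with h | rfl
      · rw [← ih h]; exact Function.update_of_ne h.ne _ _
      · rfl
  let b : ℕ → ℕ := fun i => u (i + 1) i
  have hb : ∀ k, r < μ (f '' box b k) := by
    intro k
    have : box b k = box (u k) k := by
      ext x
      exact forall₂_congr fun i hi => by rw [hstab k i hi]
    rw [this]; exact hu k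
  have hK : IsCompact (univ.pi fun i => Iic (b i) : Set (ℕ → ℕ)) :=
    isCompact_univ_pi fun i => (finite_Iic (b i)).isCompact
  refine ⟨f '' univ.pi fun i => Iic (b i), image_subset_range _ _, hK.image hf, ?_⟩
  -- Continuity from above is not available for these images. Instead, an open set of measure below
  -- `r` around the compact image would already contain the image of some cylinder.
  by_contra! hlt
  obtain ⟨U, hKU, hU, hUr⟩ := exists_isOpen_lt_of_lt _ _ hlt
  obtain ⟨k, hk⟩ := exists_cylinder_subset (hU.preimage hf) (b := b)
    fun x hx => hKU ⟨x, fun i _ => hx i, rfl⟩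
  exact (hb k).not_gt ((measure_mono (image_subset_iff.2 hk)).trans_lt hUr)

/-- Compact subsets exhaust the outer measure, so their countable union has the measure of the
measurable hull; the range lies between the two. -/
lemma nullMeasurableSet_range_of_continuous [TopologicalSpace X] [PolishSpace X] [BorelSpace X]
    (μ : Measure X) [IsFiniteMeasure μ] {f : (ℕ → ℕ) → X} (hf : Continuous f) :
    NullMeasurableSet (range f) μ := by
  rcases eq_or_ne (μ (range f)) 0 with h0 | h0
  · exact NullMeasurableSet.of_null h0
  obtain ⟨r, -, hr, hlim⟩ := exists_seq_strictMono_tendsto' (pos_iff_ne_zero.2 h0)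
  choose K hKs hK hrK using fun n => exists_isCompact_subset_range μ hf (hr n).2
  have hle : μ (range f) ≤ μ (⋃ n, K n) :=
    le_of_tendsto' hlim fun n => (hrK n).trans (measure_mono (subset_iUnion K n))
  have hKm : MeasurableSet (⋃ n, K n) := MeasurableSet.iUnion fun n => (hK n).measurableSet
  have hsub : (⋃ n, K n) ⊆ range f := iUnion_subset hKs
  refine NullMeasurableSet.congr hKm.nullMeasurableSet (Filter.EventuallyEq.symm ?_)
  have h1 : toMeasurable μ (range f) =ᵐ[μ] (⋃ n, K n : Set X) :=
    (ae_eq_of_subset_of_measure_ge (hsub.trans (subset_toMeasurable _ _))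
      (by rwa [measure_toMeasurable]) hKm.nullMeasurableSet (measure_ne_top _ _)).symm
  refine Filter.EventuallyLE.antisymm ?_ hsub.eventuallyLE
  exact (subset_toMeasurable μ (range f)).eventuallyLE.trans h1.le

lemma measurableSet_universalSigma_range_of_continuous [TopologicalSpace X] [PolishSpace X]
    [BorelSpace X] {f : (ℕ → ℕ) → X} (hf : Continuous f) :
    MeasurableSet[universalSigma X] (range f) :=
  measurableSet_universalSigma.2 fun p => nullMeasurableSet_range_of_continuous (p : Measure X) hf

lemma IsAnalytic.measurableSet_universalSigma [StandardBorelSpace X] {s : Set X}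
    (hs : IsAnalytic s) : MeasurableSet[universalSigma X] s := by
  let := upgradeStandardBorel X
  rw [isAnalytic_iff_analyticSet, AnalyticSet] at hs
  rcases hs with rfl | ⟨f, hf, rfl⟩
  · exact @MeasurableSet.empty X (universalSigma X)
  · exact measurableSet_universalSigma_range_of_continuous hf

lemma IsAnalytic.nullMeasurableSet [StandardBorelSpace X] {s : Set X} (hs : IsAnalytic s)
    (μ : Measure X) [hμ : IsProbabilityMeasure μ] : NullMeasurableSet s μ :=
  UMDP.measurableSet_universalSigma.1 hs.measurableSet_universalSigma ⟨μ, hμ⟩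

/-! ### The Jankov–von Neumann selection theorem -/

lemma measurable_sInf_nat {Ω : Type*} [MeasurableSpace Ω] {S : ℕ → Set Ω}
    (hS : ∀ n, MeasurableSet (S n)) : Measurable fun x => sInf {n | x ∈ S n} := by
  refine measurable_to_countable' fun n => ?_
  -- The second set of the union accounts for the convention `sInf ∅ = 0`.
  have h : (fun x => sInf {n | x ∈ S n}) ⁻¹' {n} =
      (S n ∩ ⋂ m, ⋂ (_ : m < n), (S m)ᶜ) ∪ ({_x | n = 0} ∩ ⋂ m, (S m)ᶜ) := by
    ext x
    simp only [mem_preimage, mem_singleton_iff, mem_union, mem_inter_iff, mem_iInter,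
      mem_compl_iff, mem_ofPred_eq]
    constructor
    · rintro rfl
      rcases eq_empty_or_nonempty {n | x ∈ S n} with he | hne
      · exact Or.inr ⟨by rw [he, Nat.sInf_empty], fun m hm => (he ▸ hm : m ∈ (∅ : Set ℕ))⟩
      · exact Or.inl ⟨Nat.sInf_mem hne, fun m hm h => Nat.notMem_of_lt_sInf hm h⟩
    · rintro (⟨h1, h2⟩ | ⟨rfl, h2⟩)
      · exact le_antisymm (Nat.sInf_le h1) (le_csInf ⟨n, h1⟩ fun m hm =>
          not_lt.1 fun hlt => h2 m hlt hm)
      · have : {n | x ∈ S n} = ∅ := eq_empty_of_forall_notMem h2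
        rw [this, Nat.sInf_empty]
  rw [h]
  exact ((hS n).inter (.iInter fun m => .iInter fun _ => (hS m).compl)).union
    ((MeasurableSet.const _).inter (.iInter fun m => (hS m).compl))

/-- A continuous map on Baire space has a universally measurable section, which picks the
lexicographically least point of the fibre. -/
lemma exists_univMeasurable_section_of_continuous [TopologicalSpace X] [PolishSpace X]
    [BorelSpace X] {F : (ℕ → ℕ) → X} (hF : Continuous F) :
    ∃ G : X → ℕ → ℕ, UnivMeasurable G ∧ ∀ x ∈ range F, F (G x) = x := by
  -- The points with a preimage that follows `u` on the first `k` coordinates and continues with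
  -- `n`. Only these coordinates of `u` matter.
  let S : ℕ → (ℕ → ℕ) → ℕ → Set X := fun k u n =>
    F '' {y | (∀ i < k, y i = u i) ∧ y k = n}
  have hS : ∀ k u n, MeasurableSet[universalSigma X] (S k u n) := fun k u n => by
    refine IsAnalytic.measurableSet_universalSigma (IsAnalytic.image ?_ hF.measurable)
    refine MeasurableSet.isAnalytic ?_
    rw [ofPred_and]
    refine MeasurableSet.inter ?_ (measurableSet_eq_fun (measurable_pi_apply k) measurable_const)
    simp only [ofPred_forall]
    exact .iInter fun i => .iInter fun _ =>
      measurableSet_eq_fun (measurable_pi_apply i) measurable_const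
  have hScongr : ∀ k u v n, (∀ i < k, u i = v i) → S k u n = S k v n := fun k u v n h => by
    simp only [S]
    congr 1
    ext y
    exact and_congr_left fun _ => forall₂_congr fun i hi => by rw [h i hi]
  -- `pre x k` holds the first `k` coordinates of the least preimage, padded by zeros; coordinate
  -- `k` is settled at step `k + 1`.
  let pre : X → ℕ → ℕ → ℕ := fun x k =>
    Nat.rec (fun _ => 0) (fun k u => Function.update u k (sInf {n | x ∈ S k u n})) k
  let G : X → ℕ → ℕ := fun x k => pre x (k + 1) k
  have hpre : ∀ x k i, i < k → pre x k i = G x i := by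
    intro x k i hik
    induction k with
    | zero => omega
    | succ k ih =>
      rcases Nat.lt_succ_iff_lt_or_eq.1 hik with h | rfl
      · rw [← ih h]; exact Function.update_of_ne h.ne _ _
      · rfl
  have hG : ∀ x k, G x k = sInf {n | x ∈ S k (G x) n} := by
    intro x k
    have h1 : G x k = sInf {n | x ∈ S k (pre x k) n} := Function.update_self _ _ _
    simp only [h1, hScongr k _ _ _ (hpre x k)]
  refine ⟨G, ?_, ?_⟩
  -- The sets defining coordinate `k` of `G x` depend on the earlier coordinates of `G x`. Fixing
  -- the prefix `u` removes this dependence; there are only countably many prefixes.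
  · have hcyl : ∀ k (u : ℕ → ℕ), MeasurableSet[universalSigma X] {x | ∀ i < k, G x i = u i} := by
      intro k u
      induction k with
      | zero => simp
      | succ k ih =>
        have : {x | ∀ i < k + 1, G x i = u i} =
            {x | ∀ i < k, G x i = u i} ∩ (fun x => sInf {n | x ∈ S k u n}) ⁻¹' {u k} := by
          ext x
          simp only [mem_ofPred_eq, mem_inter_iff, mem_preimage, mem_singleton_iff]
          constructor
          · intro h
            have h' : ∀ i < k, G x i = u i := fun i hi => h i (hi.trans (Nat.lt_succ_self k))
            refine ⟨h', ?_⟩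
            rw [← h k (Nat.lt_succ_self k), hG]
            simp only [hScongr k _ _ _ h']
          · rintro ⟨h', h⟩ i hi
            rcases Nat.lt_succ_iff_lt_or_eq.1 hi with hi | rfl
            · exact h' i hi
            · rw [hG, ← h]
              simp only [hScongr i _ _ _ h']
        rw [this]
        have hm := @measurable_sInf_nat X (universalSigma X) _ (hS k u)
        exact ih.inter (hm (measurableSet_singleton _))
    refine @measurable_pi_lambda _ _ _ (universalSigma X) _ _ fun k => ?_
    refine @measurable_to_countable' ℕ X _ _ (universalSigma X) _ fun n => ?_
    let ext : (Fin k → ℕ) → ℕ → ℕ := fun l i => if h : i < k then l ⟨i, h⟩ else n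
    have : (fun x => G x k) ⁻¹' {n} = ⋃ l : Fin k → ℕ, {x | ∀ i < k + 1, G x i = ext l i} := by
      ext x
      simp only [mem_preimage, mem_singleton_iff, mem_iUnion, mem_ofPred_eq]
      constructor
      · intro h
        refine ⟨fun i => G x i, fun i hi => ?_⟩
        rcases Nat.lt_succ_iff_lt_or_eq.1 hi with hi | rfl
        · simp [ext, hi]
        · simp [ext, h]
      · rintro ⟨l, hl⟩
        simpa [ext] using hl k (Nat.lt_succ_self k)
    rw [this]
    exact MeasurableSet.iUnion fun l => hcyl _ _
  · rintro x ⟨z, hz⟩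
    -- Points of the fibre matching ever longer prefixes of `G x` converge to `G x`, and continuity
    -- of `F` puts the limit in the fibre.
    have h : ∀ k, ∃ y, F y = x ∧ ∀ i < k, y i = G x i := by
      intro k
      induction k with
      | zero => exact ⟨z, hz, by simp⟩
      | succ k ih =>
        obtain ⟨y, hy, hyG⟩ := ih
        have hmem : sInf {n | x ∈ S k (G x) n} ∈ {n | x ∈ S k (G x) n} :=
          Nat.sInf_mem ⟨y k, y, ⟨hyG, rfl⟩, hy⟩
        obtain ⟨y', ⟨h1, h2⟩, h3⟩ := hmem
        refine ⟨y', h3, fun i hi => ?_⟩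
        rcases Nat.lt_succ_iff_lt_or_eq.1 hi with hi | rfl
        · exact h1 i hi
        · rw [h2, ← hG]
    choose y hy hyG using h
    have hlim : Filter.Tendsto y Filter.atTop (nhds (G x)) := by
      rw [tendsto_pi_nhds]
      intro i
      refine tendsto_const_nhds.congr' ?_
      filter_upwards [Filter.eventually_gt_atTop i] with k hk
      exact (hyG k i hk).symm
    have := (hF.tendsto (G x)).comp hlim
    exact tendsto_nhds_unique this (tendsto_const_nhds.congr fun k => (hy k).symm)

/-- The **Jankov–von Neumann theorem**: a measurable map between standard Borel spaces has a
universally measurable section over its range. -/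
theorem exists_univMeasurable_section [StandardBorelSpace Z] [Nonempty Z] [StandardBorelSpace X]
    {f : Z → X} (hf : Measurable f) :
    ∃ g : X → Z, UnivMeasurable g ∧ ∀ x ∈ range f, f (g x) = x := by
  let := upgradeStandardBorel X
  let := upgradeStandardBorel Z
  have hmeas : ∀ h : (ℕ → ℕ) → Z, Continuous h → Measurable h := fun _ hh => hh.measurable
  -- A finer Polish topology makes `f` continuous. A map from Baire space continuous into it is
  -- continuous, hence measurable, for the original topology too.
  obtain ⟨t, ht, hft, hpol⟩ := hf.exists_continuous
  obtain ⟨h, hh, hsurj⟩ := @PolishSpace.exists_nat_nat_continuous_surjective Z t hpol _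
  have hhm : Measurable h := hmeas h (continuous_le_rng ht hh)
  have hFc : Continuous (f ∘ h) := @Continuous.comp _ _ _ _ t _ _ _ hft hh
  obtain ⟨G, hG, hGs⟩ := exists_univMeasurable_section_of_continuous hFc
  refine ⟨h ∘ G, hhm.univMeasurable.comp hG, fun x hx => ?_⟩
  rw [← hsurj.range_comp f] at hx
  exact hGs x hx

/-- An analytic subset of a product has a universally measurable uniformization. -/
lemma IsAnalytic.exists_univMeasurable_selection [StandardBorelSpace X] [Nonempty Y]
    {D : Set (X × Y)} (hD : IsAnalytic D) :
    ∃ g : X → Y, UnivMeasurable g ∧ ∀ x y, (x, y) ∈ D → (x, g x) ∈ D := by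
  obtain ⟨Z, _, _, f, hf, rfl⟩ := hD
  rcases isEmpty_or_nonempty Z with hZ | hZ
  · exact ⟨fun _ => Classical.arbitrary Y, measurable_const.univMeasurable,
      fun x y ⟨z, _⟩ => hZ.elim z⟩
  obtain ⟨g, hg, hgs⟩ := exists_univMeasurable_section (measurable_fst.comp hf)
  refine ⟨fun x => (f (g x)).2, (measurable_snd.comp hf).univMeasurable.comp hg, ?_⟩
  rintro x y ⟨z, hz⟩
  refine ⟨g x, Prod.ext (hgs x ⟨z, by simp [hz]⟩) rfl⟩

/-- The probability measures carried by an analytic set form an analytic set. -/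
lemma IsAnalytic.setOf_measure_eq_one [StandardBorelSpace X] {s : Set X} (hs : IsAnalytic s) :
    IsAnalytic {m : ProbabilityMeasure X | (m : Measure X) s = 1} := by
  obtain ⟨Z, _, _, f, hf, rfl⟩ := hs
  let Φ : ProbabilityMeasure Z → ProbabilityMeasure X := fun μ => μ.map hf.aemeasurable
  have hΦ : Measurable Φ :=
    ((Measure.measurable_map f hf).comp measurable_subtype_coe).subtype_mk
  convert isAnalytic_range hΦ using 1
  ext m
  simp only [mem_ofPred_eq, mem_range]
  constructor
  · intro hm
    have hne : (range f).Nonempty := nonempty_of_measure_ne_zero (μ := (m : Measure X)) (by simp [hm])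
    have : Nonempty Z := range_nonempty_iff_nonempty.1 hne
    -- A measure carried by the range is lifted to `Z` by a section `g`, and `f` pushes the lift
    -- back to it.
    obtain ⟨g, hg, hgs⟩ := exists_univMeasurable_section hf
    have hga : AEMeasurable g (m : Measure X) := (hg.nullMeasurable (m : Measure X)).aemeasurable
    refine ⟨m.map hga, Subtype.ext ?_⟩
    change ((m : Measure X).map g).map f = m
    rw [AEMeasurable.map_map_of_aemeasurable hf.aemeasurable hga]
    have hae : f ∘ g =ᵐ[(m : Measure X)] id := by
      have h1 : ∀ᵐ x ∂(m : Measure X), x ∈ range f :=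
        (mem_ae_iff_prob_eq_one₀ ((isAnalytic_range hf).nullMeasurableSet _)).2 hm
      filter_upwards [h1] with x hx using hgs x hx
    rw [Measure.map_congr hae, Measure.map_id]
  · rintro ⟨μ, rfl⟩
    refine le_antisymm prob_le_one ?_
    calc (1 : ℝ≥0∞) = (μ : Measure Z) (f ⁻¹' range f) := by simp
      _ ≤ (μ : Measure Z).map f (range f) := Measure.le_map_apply hf.aemeasurable _

end UMDP

namespace UMDP

/-! ### Partial minimization of lower semianalytic functions -/

/-- The infimum need not be attained; the slack `1 / (n + 1)` makes its sublevel sets countable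
intersections of projections. -/
lemma partialInf_le_iff {X Y : Type*} {D : Set (X × Y)} {φ : X × Y → EReal} {x : X} {r : ℝ} :
    partialInf D φ x ≤ (r : EReal) ↔
      ∀ n : ℕ, ∃ y, (x, y) ∈ D ∧ φ (x, y) ≤ ((r + 1 / (n + 1) : ℝ) : EReal) := by
  constructor
  · intro h n
    have hlt : partialInf D φ x < ((r + 1 / (n + 1) : ℝ) : EReal) :=
      h.trans_lt (EReal.coe_lt_coe_iff.2 (lt_add_of_pos_right r Nat.one_div_pos_of_nat))
    simp only [partialInf, iInf_lt_iff] at hlt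
    obtain ⟨y, hy, hlt⟩ := hlt
    exact ⟨y, hy, hlt.le⟩
  · intro h
    refine le_of_forall_gt_imp_ge_of_dense fun c hc => ?_
    obtain ⟨q, hq, hqc⟩ := EReal.lt_iff_exists_real_btwn.1 hc
    obtain ⟨n, hn⟩ := exists_nat_one_div_lt (sub_pos.2 (EReal.coe_lt_coe_iff.1 hq))
    obtain ⟨y, hy, hle⟩ := h n
    exact ((iInf₂_le y hy).trans hle).trans
      ((EReal.coe_le_coe_iff.2 (by linarith)).trans hqc.le)

lemma mem_minimizerSet_iff {X Y : Type*} {D : Set (X × Y)} {φ : X × Y → EReal} {x : X} :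
    x ∈ minimizerSet D φ ↔ ∃ y, (x, y) ∈ D ∧ φ (x, y) ≤ partialInf D φ x :=
  exists_congr fun _ => and_congr_right fun _ => le_iInf₂_iff.symm

variable {X Y : Type*} [MeasurableSpace X] [MeasurableSpace Y]

lemma univMeasurable_of_sublevels {f : X → EReal}
    (h : ∀ r : ℝ, MeasurableSet[universalSigma X] {x | f x ≤ (r : EReal)}) :
    UnivMeasurable f := by
  refine @measurable_of_Iic EReal X _ _ _ (universalSigma X) _ _ _ _ fun b => ?_
  induction b using EReal.rec with
  | bot =>
    have : f ⁻¹' Iic ⊥ = ⋂ n : ℕ, {x | f x ≤ ((-n : ℝ) : EReal)} := by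
      ext x
      simp only [mem_preimage, mem_Iic, mem_iInter, mem_ofPred_eq]
      refine ⟨fun hx n => hx.trans bot_le, fun hx => ?_⟩
      refine le_of_forall_gt_imp_ge_of_dense fun c hc => ?_
      obtain ⟨q, -, hq⟩ := EReal.lt_iff_exists_real_btwn.1 hc
      obtain ⟨n, hn⟩ := exists_nat_gt (-q)
      exact (hx n).trans ((EReal.coe_le_coe_iff.2 (by linarith)).trans hq.le)
    rw [this]
    exact MeasurableSet.iInter fun n => h _
  | coe r => exact h r
  | top =>
    have : f ⁻¹' Iic ⊤ = univ := by ext; simp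
    rw [this]
    exact @MeasurableSet.univ X (universalSigma X)

lemma LowerSemianalyticOn.partialInf [StandardBorelSpace X] {D : Set (X × Y)}
    {φ : X × Y → EReal} (hφ : HasAnalyticSublevels D φ) :
    LowerSemianalyticOn univ (partialInf D φ) := by
  refine ⟨MeasurableSet.univ.isAnalytic, fun r => ?_⟩
  have : {x | x ∈ univ ∧ UMDP.partialInf D φ x ≤ (r : EReal)} = ⋂ n : ℕ,
      Prod.fst '' {z | z ∈ D ∧ φ z ≤ ((r + 1 / (n + 1) : ℝ) : EReal)} := by
    ext x
    simp [partialInf_le_iff]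
  rw [this]
  exact IsAnalytic.iInter fun n => (hφ _).image measurable_fst

lemma HasAnalyticSublevels.mono [StandardBorelSpace X] {D D' : Set X} {f : X → EReal}
    (h : HasAnalyticSublevels D f) (hD' : IsAnalytic D') (hsub : D' ⊆ D) :
    HasAnalyticSublevels D' f := fun r => by
  convert hD'.inter (h r) using 1
  ext x
  exact ⟨fun hx => ⟨hx.1, hsub hx.1, hx.2⟩, fun hx => ⟨hx.1, hx.2.2⟩⟩

lemma LowerSemianalyticOn.univMeasurable [StandardBorelSpace X] {f : X → EReal}
    (h : LowerSemianalyticOn univ f) : UnivMeasurable f :=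
  univMeasurable_of_sublevels fun r => by simpa using (h.2 r).measurableSet_universalSigma

/-- By density of the rationals, `f x ≤ b` holds exactly when every rational `q` satisfies `q ≤ b`
or `f x ≤ q`. -/
lemma LowerSemianalyticOn.isAnalytic_epigraph [StandardBorelSpace X] {D : Set X} {f : X → EReal}
    (h : LowerSemianalyticOn D f) : IsAnalytic {z : X × EReal | z.1 ∈ D ∧ f z.1 ≤ z.2} := by
  have : {z : X × EReal | z.1 ∈ D ∧ f z.1 ≤ z.2} = ⋂ q : ℚ,
      (Prod.fst ⁻¹' D ∩ {z | ((q : ℝ) : EReal) ≤ z.2}) ∪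
        Prod.fst ⁻¹' {x | x ∈ D ∧ f x ≤ ((q : ℝ) : EReal)} := by
    ext ⟨x, b⟩
    simp only [mem_ofPred_eq, mem_iInter, mem_union, mem_inter_iff, mem_preimage]
    constructor
    · rintro ⟨hx, hb⟩ q
      rcases le_total ((q : ℝ) : EReal) b with h | h
      · exact Or.inl ⟨hx, h⟩
      · exact Or.inr ⟨hx, hb.trans h⟩
    · intro H
      refine ⟨(H 0).elim And.left And.left, le_of_forall_gt_imp_ge_of_dense fun c hc => ?_⟩
      obtain ⟨q, hq, hqc⟩ := EReal.lt_iff_exists_rat_btwn.1 hc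
      rcases H q with h | h
      · exact absurd h.2 hq.not_ge
      · exact h.2.trans hqc.le
  rw [this]
  refine IsAnalytic.iInter fun q => ((h.1.preimage measurable_fst).inter ?_).union
    ((h.2 _).preimage measurable_fst)
  exact (measurableSet_le measurable_const measurable_snd).isAnalytic

/-- Universally measurable `ε`-optimal selectors, which are exact wherever the infimum is
attained. -/
theorem exists_univMeasurable_isEpsOptimal [StandardBorelSpace X] [StandardBorelSpace Y]
    {D : Set (X × Y)} {φ : X × Y → EReal} (hφ : LowerSemianalyticOn D φ)
    (hne : ∀ x, ∃ y, (x, y) ∈ D) {ε : ℝ} (hε : 0 < ε) :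
    ∃ ζ : X → Y, UnivMeasurable ζ ∧ (∀ x, (x, ζ x) ∈ D) ∧
      IsEpsOptimal φ (partialInf D φ) (minimizerSet D φ) ε ζ := by
  classical
  rcases isEmpty_or_nonempty X with hX | ⟨⟨x₀⟩⟩
  · exact ⟨isEmptyElim, fun s _ => by
      convert @MeasurableSet.empty X (universalSigma X)
      exact eq_empty_of_isEmpty _, isEmptyElim, isEmptyElim, isEmptyElim⟩
  have : Nonempty Y := ⟨(hne x₀).choose⟩
  let v := partialInf D φ
  have hv : UnivMeasurable v := (LowerSemianalyticOn.partialInf hφ.2).univMeasurable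
  -- One selection serves all levels: `σ (x, b)` meets the cost level `b` whenever this is possible,
  -- and the level is chosen afterwards as a function of `x`.
  let E : Set ((X × EReal) × Y) := {w | (w.1.1, w.2) ∈ D ∧ φ (w.1.1, w.2) ≤ w.1.2}
  have hE : IsAnalytic E := by
    have hg : Measurable fun w : (X × EReal) × Y => ((w.1.1, w.2), w.1.2) := by fun_prop
    exact hφ.isAnalytic_epigraph.preimage hg
  obtain ⟨σ, hσ, hσE⟩ := hE.exists_univMeasurable_selection
  have hmin : MeasurableSet[universalSigma X] (minimizerSet D φ) := by
    have hp := (hE.image measurable_fst).measurableSet_universalSigma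
    have := (measurable_id.univMeasurable.prodMk hv).measurable_universalSigma hp
    convert this using 1
    ext x
    rw [mem_minimizerSet_iff]
    simp [E, v]
  let b : X → EReal := fun x => if x ∈ minimizerSet D φ then v x else
    if v x = ⊥ then ((-1 / ε : ℝ) : EReal) else v x + (ε : EReal)
  have hadd : Measurable fun t : EReal => t + (ε : EReal) :=
    Monotone.measurable fun s t h => add_le_add_left h _
  have hb : UnivMeasurable b := by
    refine UnivMeasurable.ite hmin hv (UnivMeasurable.ite (hv (measurableSet_singleton ⊥)) ?_ ?_)
    · exact measurable_const.univMeasurable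
    · exact hadd.univMeasurable.comp hv
  have hbE : ∀ x, ∃ y, ((x, b x), y) ∈ E := by
    intro x
    by_cases hx : x ∈ minimizerSet D φ
    · simpa [b, hx, E] using mem_minimizerSet_iff.1 hx
    have key : v x < b x → ∃ y, ((x, b x), y) ∈ E := fun hlt => by
      obtain ⟨y, hy, hlt⟩ := by simpa only [v, partialInf, iInf_lt_iff] using hlt
      exact ⟨y, hy, hlt.le⟩
    apply key
    by_cases hbot : v x = ⊥
    · simp only [b, hx, hbot, if_true, if_false]
      exact EReal.bot_lt_coe _
    -- Where the value is `⊤` every feasible point is a minimizer. Off the minimizer set a finite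
    -- value therefore lies strictly below `v x + ε`.
    · have htop : v x ≠ ⊤ := fun h => hx <| by
        obtain ⟨y, hy⟩ := hne x
        exact mem_minimizerSet_iff.2 ⟨y, hy, le_top.trans h.ge⟩
      simp only [b, hx, hbot, if_false]
      lift v x to ℝ using ⟨htop, hbot⟩ with r
      exact_mod_cast lt_add_of_pos_right r hε
  have hζ : ∀ x, ((x, b x), σ (x, b x)) ∈ E := fun x =>
    let ⟨y, hy⟩ := hbE x; hσE (x, b x) y hy
  refine ⟨fun x => σ (x, b x), hσ.comp (measurable_id.univMeasurable.prodMk hb),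
    fun x => (hζ x).1, fun x hx => ?_, fun x hx => ⟨fun hv' => ?_, fun hv' => ?_⟩⟩
  · have h := (hζ x).2
    simp only [b, hx, if_true] at h ⊢
    exact le_antisymm h (iInf₂_le _ (by simpa only [b, hx, if_true] using (hζ x).1))
  · have h := (hζ x).2
    have hbx : b x = v x + (ε : EReal) := by simp only [b, hx, if_false]; exact if_neg hv'
    exact h.trans_eq hbx
  · have h := (hζ x).2
    have hbx : b x = ((-1 / ε : ℝ) : EReal) := by simp only [b, hx, if_false]; exact if_pos hv'
    exact h.trans_eq hbx

end UMDP

namespace UMDP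

/-! ### Probability measures as kernels -/

section Kernels

variable {Ω H Y B : Type*} [MeasurableSpace Ω] [MeasurableSpace H] [MeasurableSpace Y]
  [MeasurableSpace B]

/-- The tautological kernel `p ↦ p`. -/
noncomputable def evalKernel (Ω : Type*) [MeasurableSpace Ω] : Kernel (ProbabilityMeasure Ω) Ω :=
  ⟨fun p => (p : Measure Ω), measurable_subtype_coe⟩

instance : IsMarkovKernel (evalKernel Ω) := ⟨fun p => p.2⟩

/-- A Markov kernel as a map into the space of probability measures. -/
noncomputable def kernelToProb (κ : Kernel Ω Y) [IsMarkovKernel κ] (ω : Ω) : ProbabilityMeasure Y :=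
  ⟨κ ω, inferInstance⟩

@[simp]
lemma coe_kernelToProb (κ : Kernel Ω Y) [IsMarkovKernel κ] (ω : Ω) :
    (kernelToProb κ ω : Measure Y) = κ ω := rfl

lemma measurable_kernelToProb (κ : Kernel Ω Y) [IsMarkovKernel κ] :
    Measurable (kernelToProb κ) :=
  κ.measurable.subtype_mk

lemma measurable_diracProba : Measurable (diracProba : Y → ProbabilityMeasure Y) :=
  Measure.measurable_dirac.subtype_mk

lemma measurableSet_kernel_eq [StandardBorelSpace Y] (κ η : Kernel Ω Y) [IsMarkovKernel κ]
    [IsMarkovKernel η] : MeasurableSet {ω | κ ω = η ω} := by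
  convert measurableSet_eq_fun (measurable_kernelToProb κ) (measurable_kernelToProb η) using 1
  ext ω
  exact ⟨fun h => Subtype.ext h, fun h => congrArg Subtype.val h⟩

lemma exists_countable_separating (Y : Type*) [MeasurableSpace Y]
    [MeasurableSpace.CountablyGenerated Y] :
    ∃ 𝒞 : Set (Set Y), 𝒞.Countable ∧ (∀ B ∈ 𝒞, MeasurableSet B) ∧
      ∀ μ ν : Measure Y, IsProbabilityMeasure μ → IsProbabilityMeasure ν →
        (∀ B ∈ 𝒞, μ B = ν B) → μ = ν := by
  have hgen : ‹MeasurableSpace Y› = MeasurableSpace.generateFrom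
      (generateSetAlgebra (MeasurableSpace.countableGeneratingSet Y)) := by
    rw [generateFrom_generateSetAlgebra_eq, MeasurableSpace.generateFrom_countableGeneratingSet]
  refine ⟨generateSetAlgebra (MeasurableSpace.countableGeneratingSet Y),
    countable_generateSetAlgebra (MeasurableSpace.countable_countableGeneratingSet),
    fun B hB => hgen ▸ MeasurableSpace.measurableSet_generateFrom hB, fun μ ν _ _ h => ?_⟩
  refine ext_of_generate_finite _ hgen ?_ h (by simp)
  exact fun s hs t ht _ => isSetAlgebra_generateSetAlgebra.inter_mem hs ht

/-- A countable generating algebra determines probability measures, so the exceptional sets, one for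
each test set, have a null union. -/
lemma ae_eq_of_forall_measure_ae_eq [MeasurableSpace.CountablyGenerated Y] {m : Measure Ω}
    {f g : Ω → Measure Y} (hf : ∀ ω, IsProbabilityMeasure (f ω))
    (hg : ∀ ω, IsProbabilityMeasure (g ω))
    (h : ∀ B, MeasurableSet B → (fun ω => f ω B) =ᵐ[m] fun ω => g ω B) : f =ᵐ[m] g := by
  obtain ⟨𝒞, hc, hm, hsep⟩ := exists_countable_separating Y
  have : ∀ᵐ ω ∂m, ∀ B ∈ 𝒞, f ω B = g ω B := (ae_ball_iff hc).2 fun B hB => h B (hm B hB)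
  filter_upwards [this] with ω hω using hsep _ _ (hf ω) (hg ω) hω

/-- A kernel is a regular conditional distribution of `g` given `f` if and only if it
disintegrates the joint law. -/
lemma map_prodMk_eq_compProd_iff (p : Measure Ω) [IsProbabilityMeasure p] {f : Ω → H} {g : Ω → B}
    (hf : Measurable f) (hg : Measurable g) (κ : Kernel H B) [IsMarkovKernel κ] :
    p.map (fun ω => (f ω, g ω)) = p.map f ⊗ₘ κ ↔
      ∀ C D, MeasurableSet C → MeasurableSet D →
        p {ω | f ω ∈ C ∧ g ω ∈ D} = ∫⁻ ω in {ω | f ω ∈ C}, κ (f ω) D ∂p := by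
  have h1 : ∀ C D, MeasurableSet C → MeasurableSet D →
      p.map (fun ω => (f ω, g ω)) (C ×ˢ D) = p {ω | f ω ∈ C ∧ g ω ∈ D} := fun C D hC hD =>
    Measure.map_apply (hf.prodMk hg) (hC.prod hD)
  have h2 : ∀ C D, MeasurableSet C → MeasurableSet D →
      (p.map f ⊗ₘ κ) (C ×ˢ D) = ∫⁻ ω in {ω | f ω ∈ C}, κ (f ω) D ∂p := fun C D hC hD => by
    have := Measure.isProbabilityMeasure_map (μ := p) hf.aemeasurable
    rw [Measure.compProd_apply_prod hC hD, setLIntegral_map hC (Kernel.measurable_coe _ hD) hf]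
    rfl
  have := Measure.isProbabilityMeasure_map (μ := p) hf.aemeasurable
  have := Measure.isProbabilityMeasure_map (μ := p) (hf.prodMk hg).aemeasurable
  constructor
  · intro h C D hC hD
    rw [← h1 C D hC hD, ← h2 C D hC hD, h]
  · intro h
    refine Measure.ext_prod fun {C D} hC hD => ?_
    rw [h1 C D hC hD, h2 C D hC hD, h C D hC hD]

/-- The condition says that two Markov kernels in `p` coincide, the joint law and the composition of
the marginal with `κ (p, ·)`. Coincidence of Borel maps into a standard Borel space is a Borel
condition. -/
lemma measurableSet_isCondDistrib [StandardBorelSpace H] [StandardBorelSpace B] {f : Ω → H}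
    {g : Ω → B} (hf : Measurable f) (hg : Measurable g) (κ : Kernel (ProbabilityMeasure Ω × H) B)
    [IsMarkovKernel κ] :
    MeasurableSet {p : ProbabilityMeasure Ω | ∀ C D, MeasurableSet C → MeasurableSet D →
      (p : Measure Ω) {ω | f ω ∈ C ∧ g ω ∈ D} =
        ∫⁻ ω in {ω | f ω ∈ C}, κ (p, f ω) D ∂(p : Measure Ω)} := by
  have : IsMarkovKernel ((evalKernel Ω).map f) := Kernel.IsMarkovKernel.map _ hf
  have : IsMarkovKernel ((evalKernel Ω).map fun ω => (f ω, g ω)) :=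
    Kernel.IsMarkovKernel.map _ (hf.prodMk hg)
  convert measurableSet_kernel_eq ((evalKernel Ω).map fun ω => (f ω, g ω))
    ((evalKernel Ω).map f ⊗ₖ κ) using 1
  ext p
  simp only [mem_ofPred_eq]
  rw [Kernel.compProd_apply_eq_compProd_sectR, Kernel.map_apply _ hf,
    Kernel.map_apply _ (hf.prodMk hg)]
  exact (map_prodMk_eq_compProd_iff (p : Measure Ω) hf hg (κ.sectR p)).symm

lemma isAnalytic_setOf_and [StandardBorelSpace Ω] {P Q : Ω → Prop} (hP : IsAnalytic {ω | P ω})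
    (hQ : IsAnalytic {ω | Q ω}) : IsAnalytic {ω | P ω ∧ Q ω} := hP.inter hQ

lemma isAnalytic_setOf_forall [StandardBorelSpace Ω] {ι : Type*} [Countable ι] {P : ι → Ω → Prop}
    (hP : ∀ i, IsAnalytic {ω | P i ω}) : IsAnalytic {ω | ∀ i, P i ω} := by
  rw [ofPred_forall]
  exact IsAnalytic.iInter hP

/-- For an analytic set `V` the condition `F (p, ω) ∈ V` for `p`-almost all `ω` is analytic
in `p`. -/
lemma isAnalytic_setOf_ae_mem [StandardBorelSpace Ω] [StandardBorelSpace Y]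
    {F : ProbabilityMeasure Ω × Ω → Y} (hF : Measurable F) {V : Set Y} (hV : IsAnalytic V) :
    IsAnalytic {p : ProbabilityMeasure Ω | ∀ᵐ ω ∂(p : Measure Ω), F (p, ω) ∈ V} := by
  let κ : Kernel (ProbabilityMeasure Ω) Y := (Kernel.id ×ₖ evalKernel Ω).map F
  have : IsMarkovKernel κ := Kernel.IsMarkovKernel.map _ hF
  convert hV.setOf_measure_eq_one.preimage (measurable_kernelToProb κ) using 1
  ext p
  have hFp : Measurable fun ω => F (p, ω) := hF.comp measurable_prodMk_left
  have hκ : κ p = (p : Measure Ω).map fun ω => F (p, ω) := by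
    rw [Kernel.map_apply _ hF, Kernel.prod_apply, Kernel.id_apply, Measure.dirac_prod,
      Measure.map_map hF measurable_prodMk_left]
    rfl
  have hpr : IsProbabilityMeasure ((p : Measure Ω).map fun ω => F (p, ω)) :=
    Measure.isProbabilityMeasure_map hFp.aemeasurable
  have hVn := hV.nullMeasurableSet ((p : Measure Ω).map fun ω => F (p, ω))
  simp only [mem_ofPred_eq, mem_preimage, coe_kernelToProb]
  rw [hκ, Measure.map_apply₀ hFp.aemeasurable hVn]
  exact mem_ae_iff_prob_eq_one₀ (hVn.preimage (hFp.quasiMeasurePreserving _))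

/-- The section has full `m`-measure exactly when the image of `m` under `y ↦ (x, y)` is carried by
`Γ`, and this image is Borel in `(x, m)`. -/
lemma isAnalytic_setOf_section_eq_one [StandardBorelSpace Ω] [StandardBorelSpace Y]
    {Γ : Set (Ω × Y)} (hΓ : IsAnalytic Γ) :
    IsAnalytic {z : Ω × ProbabilityMeasure Y | (z.2 : Measure Y) {y | (z.1, y) ∈ Γ} = 1} := by
  let κ : Kernel (Ω × ProbabilityMeasure Y) (Ω × Y) :=
    Kernel.deterministic Prod.fst measurable_fst ×ₖ (evalKernel Y).comap Prod.snd measurable_snd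
  convert hΓ.setOf_measure_eq_one.preimage (measurable_kernelToProb κ) using 1
  ext ⟨x, m⟩
  have hκ : κ (x, m) = (m : Measure Y).map (Prod.mk x) := by
    rw [Kernel.prod_apply, Kernel.deterministic_apply, Measure.dirac_prod]
    rfl
  have hpr : IsProbabilityMeasure ((m : Measure Y).map (Prod.mk x)) :=
    Measure.isProbabilityMeasure_map measurable_prodMk_left.aemeasurable
  simp only [mem_ofPred_eq, mem_preimage, coe_kernelToProb]
  rw [hκ, Measure.map_apply₀ measurable_prodMk_left.aemeasurable (hΓ.nullMeasurableSet _)]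
  rfl

/-- By the Lusin–Souslin theorem for the injective Borel map `diracProba`. Nonrandomization thereby
becomes a Borel constraint on action distributions. -/
lemma measurableSet_range_diracProba [StandardBorelSpace Y] :
    MeasurableSet (range (diracProba : Y → ProbabilityMeasure Y)) := by
  have hinj : Function.Injective (diracProba : Y → ProbabilityMeasure Y) := fun a b h =>
    injective_diracProba h
  exact (measurable_diracProba.measurableEmbedding hinj).measurableSet_range

end Kernels

/-! ### Policies that act on a statistic of the history -/

lemma measurable_first {X A : Type*} [MeasurableSpace X] [MeasurableSpace A] (n : ℕ) :
    Measurable (Hist.first : Hist X A n → X) := by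
  cases n with
  | zero => exact measurable_snd
  | succ n => exact measurable_fst.comp ((measurable_pi_apply 0).comp measurable_fst)

lemma first_histAt {X A : Type*} (n : ℕ) (ω : Traj X A) : (histAt n ω).first = (ω 0).1 := by
  cases n <;> rfl

/-- A statistic `key n h_n` of the history that determines the current state. -/
structure Statistic (X A S : Type*) [MeasurableSpace X] [MeasurableSpace A]
    [MeasurableSpace S] where
  key : ∀ n, Hist X A n → S
  measurable_key : ∀ n, Measurable (key n)
  state : S → X
  measurable_state : Measurable state
  state_key : ∀ n h, state (key n h) = Hist.last h

namespace Statistic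

variable {X A S : Type*} [MeasurableSpace X] [MeasurableSpace A] [MeasurableSpace S]

/-- The policies whose actions depend on the history through the statistic `T` only, with all
action distributions in `W`. -/
def policies (T : Statistic X A S) (M : MDP X A) (W : Set (ProbabilityMeasure A)) :
    Set (Policy M) :=
  {π | (∃ ν : S → ProbabilityMeasure A, UnivMeasurable ν ∧
    ∀ n h, π.kernel n h = ν (T.key n h)) ∧ ∀ n h, π.kernel n h ∈ W}

/-- The admissible pairs of a state and an action distribution in `W`. -/
def _root_.UMDP.MDP.admissible (M : MDP X A) (W : Set (ProbabilityMeasure A)) :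
    Set (X × ProbabilityMeasure A) :=
  {z | z.2 ∈ W ∧ (z.2 : Measure A) (M.adm z.1) = 1}

lemma _root_.UMDP.MDP.isAnalytic_admissible [StandardBorelSpace X] [StandardBorelSpace A]
    (M : MDP X A) {W : Set (ProbabilityMeasure A)} (hW : MeasurableSet W) :
    IsAnalytic (M.admissible W) :=
  (measurable_snd hW).isAnalytic.inter (isAnalytic_setOf_section_eq_one M.adm_analytic)

/-- A probability measure on the stages that charges all of them. -/
noncomputable def stageWeight : Measure ℕ := Measure.count.toFinite

instance : IsProbabilityMeasure stageWeight := by unfold stageWeight; infer_instance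

lemma forall_of_ae_stageWeight {P : ℕ → Prop} (h : ∀ᵐ n ∂stageWeight, P n) (n : ℕ) : P n := by
  have := absolutelyContinuous_toFinite (Measure.count : Measure ℕ) h
  rw [Measure.count_eq_zero_iff] at this
  by_contra hn
  exact (this ▸ hn : n ∈ (∅ : Set ℕ))

/-! ### Occupation measures and conditional action distributions -/

variable (T : Statistic X A S)

/-- The statistic and the action at a given stage. -/
def pair (z : ℕ × Traj X A) : S × A := (T.key z.1 (histAt z.1 z.2), (z.2 z.1).2)

lemma measurable_pair : Measurable T.pair := by
  refine measurable_from_prod_countable_right fun n => ?_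
  exact ((T.measurable_key n).comp (measurable_histAt n)).prodMk (by fun_prop)

/-- The joint law of statistic and action at a random stage. -/
noncomputable def occupation : Kernel (ProbabilityMeasure (Traj X A)) (S × A) :=
  (Kernel.const _ stageWeight ×ₖ evalKernel (Traj X A)).map T.pair

instance : IsMarkovKernel T.occupation := Kernel.IsMarkovKernel.map _ T.measurable_pair

lemma occupation_apply (p : ProbabilityMeasure (Traj X A)) :
    T.occupation p = (stageWeight.prod (p : Measure (Traj X A))).map T.pair := by
  rw [occupation, Kernel.map_apply _ T.measurable_pair, Kernel.prod_apply]
  rfl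

/-- Since `stageWeight` charges every stage, an occupation-null set of values of the statistic is
null at each stage separately. -/
lemma ae_of_ae_occupation {p : ProbabilityMeasure (Traj X A)} {P : S → Prop}
    (h : ∀ᵐ s ∂(T.occupation p).fst, P s) (n : ℕ) :
    ∀ᵐ ω ∂(p : Measure (Traj X A)), P (T.key n (histAt n ω)) := by
  have h1 := ae_of_ae_map measurable_fst.aemeasurable h
  rw [occupation_apply] at h1
  have h2 := ae_of_ae_map T.measurable_pair.aemeasurable h1
  exact forall_of_ae_stageWeight (Measure.ae_ae_of_ae_prod h2) n

variable [StandardBorelSpace S] [StandardBorelSpace A] [Nonempty A]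

/-- The conditional distribution of the action given the statistic, jointly measurable in the
strategic measure and the statistic. -/
noncomputable def cond : Kernel (ProbabilityMeasure (Traj X A) × S) A :=
  T.occupation.condKernel

instance : IsMarkovKernel T.cond := by unfold cond; infer_instance

/-- Averaging the hypothesis over the stages shows that `η` disintegrates the occupation measure;
disintegrations are almost surely unique. The randomized stage lets one kernel serve all stages, as
stationarity requires. -/
lemma cond_ae_eq {p : ProbabilityMeasure (Traj X A)} {η : Kernel S A} [IsMarkovKernel η]
    (h : ∀ n C D, MeasurableSet C → MeasurableSet D →
      (p : Measure (Traj X A)) {ω | T.key n (histAt n ω) ∈ C ∧ (ω n).2 ∈ D} =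
        ∫⁻ ω in {ω | T.key n (histAt n ω) ∈ C}, η (T.key n (histAt n ω)) D
          ∂(p : Measure (Traj X A))) :
    ∀ᵐ s ∂(T.occupation p).fst, T.cond (p, s) = η s := by
  have h1 : T.occupation p = (T.occupation p).fst ⊗ₘ T.cond.sectR p := by
    conv_lhs => rw [← Kernel.disintegrate T.occupation T.occupation.condKernel]
    rw [Kernel.compProd_apply_eq_compProd_sectR, Kernel.fst_apply]
    rfl
  let f : ℕ × Traj X A → S := fun z => (T.pair z).1
  let g : ℕ × Traj X A → A := fun z => (T.pair z).2
  have hf : Measurable f := measurable_fst.comp T.measurable_pair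
  have hg : Measurable g := measurable_snd.comp T.measurable_pair
  have hfst : (T.occupation p).fst = (stageWeight.prod (p : Measure (Traj X A))).map f := by
    rw [occupation_apply, Measure.fst, Measure.map_map measurable_fst T.measurable_pair]
    rfl
  have h2 : T.occupation p = (T.occupation p).fst ⊗ₘ η := by
    rw [hfst, T.occupation_apply]
    refine (map_prodMk_eq_compProd_iff _ hf hg η).2 fun C D hC hD => ?_
    change (stageWeight.prod _) (f ⁻¹' C ∩ g ⁻¹' D) = ∫⁻ ω in f ⁻¹' C, _ ∂_
    have hind : Measurable ((f ⁻¹' C).indicator fun z => η (f z) D) :=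
      ((Kernel.measurable_coe η hD).comp hf).indicator (hf hC)
    rw [Measure.prod_apply ((hf hC).inter (hg hD)), ← lintegral_indicator (hf hC),
      lintegral_prod _ hind.aemeasurable]
    refine lintegral_congr fun n => (h n C D hC hD).trans ?_
    exact (lintegral_indicator (((T.measurable_key n).comp (measurable_histAt n)) hC) _).symm
  exact Kernel.ae_eq_of_compProd_eq (h1.symm.trans h2)

/-- Under a policy that factors through the statistic, the conditional distributions are given by
the policy. -/
lemma cond_ae_eq_kernel {M : MDP X A} {W : Set (ProbabilityMeasure A)} {π : Policy M}
    (hπ : π ∈ T.policies M W) {p₀ : ProbabilityMeasure X} {p : ProbabilityMeasure (Traj X A)}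
    (hp : IsInducedBy π p₀ p) (n : ℕ) :
    ∀ᵐ ω ∂(p : Measure (Traj X A)),
      T.cond (p, T.key n (histAt n ω)) = π.kernel n (histAt n ω) := by
  obtain ⟨⟨ν, hν, hπν⟩, -⟩ := hπ
  -- The policy is only universally measurable; a Borel version for the occupation measure of this
  -- `p` mediates between it and `cond`.
  obtain ⟨η, hη, hηk⟩ := exists_kernel_version (T.occupation p).fst (isUnivKernel_iff.2 hν)
  have h1 : ∀ᵐ s ∂(T.occupation p).fst, η s = ν s :=
    ae_eq_of_forall_measure_ae_eq (fun s => hη.isProbabilityMeasure s) (fun s => (ν s).2) hηk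
  have h1n := T.ae_of_ae_occupation h1
  have h2 : ∀ᵐ s ∂(T.occupation p).fst, T.cond (p, s) = η s := by
    refine T.cond_ae_eq fun n C D hC hD => ?_
    refine (hp.action n (T.key n ⁻¹' C) D (T.measurable_key n hC) hD).trans ?_
    refine lintegral_congr_ae (ae_restrict_of_ae ?_)
    filter_upwards [h1n n] with ω hω
    rw [hω, hπν]
  filter_upwards [T.ae_of_ae_occupation h2 n, h1n n] with ω h3 h4
  rw [h3, h4, hπν]

/-- The pairs of an initial state and a strategic measure, described by conditions on the
conditional distributions. -/
def feasible (M : MDP X A) (W : Set (ProbabilityMeasure A)) :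
    Set (X × ProbabilityMeasure (Traj X A)) :=
  {z | (z.2 : Measure (Traj X A)).map (fun ω => (ω 0).1) = Measure.dirac z.1 ∧
    (∀ n C B, MeasurableSet C → MeasurableSet B →
      (z.2 : Measure (Traj X A)) {ω | pathAt n ω ∈ C ∧ (ω (n + 1)).1 ∈ B} =
        ∫⁻ ω in {ω | pathAt n ω ∈ C}, M.q (ω n) B ∂(z.2 : Measure _)) ∧
    (∀ n C B, MeasurableSet C → MeasurableSet B →
      (z.2 : Measure (Traj X A)) {ω | histAt n ω ∈ C ∧ (ω n).2 ∈ B} =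
        ∫⁻ ω in {ω | histAt n ω ∈ C}, T.cond (z.2, T.key n (histAt n ω)) B ∂(z.2 : Measure _)) ∧
    ∀ n, ∀ᵐ ω ∂(z.2 : Measure (Traj X A)), (T.state (T.key n (histAt n ω)),
      kernelToProb T.cond (z.2, T.key n (histAt n ω))) ∈ M.admissible W}

variable [StandardBorelSpace X] (M : MDP X A) {W : Set (ProbabilityMeasure A)}

/-- The initial, transition and action conditions are Borel. Only admissibility is merely analytic,
inheriting this from the graph of the action sets. -/
lemma isAnalytic_feasible (hW : MeasurableSet W) : IsAnalytic (T.feasible M W) := by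
  have hx : Measurable fun ω : Traj X A => (ω 0).1 := by fun_prop
  unfold feasible
  refine isAnalytic_setOf_and (MeasurableSet.isAnalytic ?_)
    (isAnalytic_setOf_and (isAnalytic_setOf_forall fun n => MeasurableSet.isAnalytic ?_)
      (isAnalytic_setOf_and (isAnalytic_setOf_forall fun n => MeasurableSet.isAnalytic ?_)
        (isAnalytic_setOf_forall fun n => ?_)))
  · have : IsMarkovKernel ((evalKernel (Traj X A)).map fun ω => (ω 0).1) :=
      Kernel.IsMarkovKernel.map _ hx
    convert measurableSet_kernel_eq
      (((evalKernel (Traj X A)).map fun ω => (ω 0).1).comap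
        (Prod.snd : X × ProbabilityMeasure (Traj X A) → _) measurable_snd)
      (Kernel.deterministic Prod.fst measurable_fst) using 1
    ext z
    rw [mem_ofPred_eq, mem_ofPred_eq, Kernel.comap_apply, Kernel.map_apply _ hx, Kernel.deterministic_apply]
    rfl
  · have hq : Measurable fun w : ProbabilityMeasure (Traj X A) × (Fin (n + 1) → X × A) =>
        w.2 (Fin.last n) := by fun_prop
    exact measurable_snd <| measurableSet_isCondDistrib (measurable_pathAt n)
      (g := fun ω : Traj X A => (ω (n + 1)).1) (by fun_prop) (M.q.comap _ hq)
  · have hk : Measurable fun w : ProbabilityMeasure (Traj X A) × Hist X A n =>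
        (w.1, T.key n w.2) := by have := T.measurable_key n; fun_prop
    exact measurable_snd <| measurableSet_isCondDistrib (measurable_histAt n)
      (g := fun ω : Traj X A => (ω n).2) (by fun_prop) (T.cond.comap _ hk)
  · have hk : Measurable fun w : ProbabilityMeasure (Traj X A) × Traj X A =>
        (w.1, T.key n (histAt n w.2)) := by have := T.measurable_key n; fun_prop
    have hF : Measurable fun w : ProbabilityMeasure (Traj X A) × Traj X A =>
        (T.state (T.key n (histAt n w.2)), kernelToProb T.cond (w.1, T.key n (histAt n w.2))) :=
      (T.measurable_state.comp (measurable_snd.comp hk)).prodMk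
        ((measurable_kernelToProb _).comp hk)
    exact (isAnalytic_setOf_ae_mem hF (M.isAnalytic_admissible hW)).preimage measurable_snd

/-- The conditional distribution of the action, modified to be admissible everywhere. -/
lemma exists_admissible_version (hW : MeasurableSet W) (hdirac : ∀ a, diracProba a ∈ W) :
    ∃ k : ProbabilityMeasure (Traj X A) × S → ProbabilityMeasure A, UnivMeasurable k ∧
      (∀ p s, (T.state s, k (p, s)) ∈ M.admissible W) ∧
      ∀ p s, (T.state s, kernelToProb T.cond (p, s)) ∈ M.admissible W →
        (k (p, s) : Measure A) = T.cond (p, s) := by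
  classical
  obtain ⟨α, hα, hαM⟩ := M.adm_analytic.exists_univMeasurable_selection
  have hst : Measurable fun w : ProbabilityMeasure (Traj X A) × S => T.state w.2 :=
    T.measurable_state.comp measurable_snd
  -- Inadmissible values are replaced by the Dirac mass at a selected admissible action. The case
  -- distinction is along an analytic set, so the result is universally measurable.
  refine ⟨fun w => if (T.state w.2, kernelToProb T.cond w) ∈ M.admissible W then
    kernelToProb T.cond w else diracProba (α (T.state w.2)), ?_, fun p s => ?_, fun p s h => ?_⟩
  · refine UnivMeasurable.ite ?_ (measurable_kernelToProb _).univMeasurable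
      (measurable_diracProba.univMeasurable.comp (hα.comp hst.univMeasurable))
    exact ((M.isAnalytic_admissible hW).preimage
      (hst.prodMk (measurable_kernelToProb T.cond))).measurableSet_universalSigma
  · by_cases h : (T.state s, kernelToProb T.cond (p, s)) ∈ M.admissible W
    · simp only [h, if_true]
    · simp only [h, if_false]
      obtain ⟨a, ha⟩ := M.adm_nonempty (T.state s)
      exact ⟨hdirac _, Measure.dirac_apply_of_mem (hαM _ a ha)⟩
  · simp only [h, if_true, coe_kernelToProb]

/-! ### Strategic measures and the policies that generate them -/

variable {M}

/-- Agreement with `cond` is needed only on histories that start at `x` and where `cond` is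
admissible, since `p` charges no others. This freedom lets one policy serve all initial states. -/
lemma isInducedBy_of_mem_feasible {x : X} {p : ProbabilityMeasure (Traj X A)}
    (hp : (x, p) ∈ T.feasible M W) {π : Policy M}
    (hπ : ∀ n (h : Hist X A n), h.first = x →
      (T.state (T.key n h), kernelToProb T.cond (p, T.key n h)) ∈ M.admissible W →
        (π.kernel n h : Measure A) = T.cond (p, T.key n h)) :
    IsInducedBy π (diracProba x) p := by
  obtain ⟨h0, htr, hact, hadm⟩ := hp
  have hx : Measurable fun ω : Traj X A => (ω 0).1 := by fun_prop
  refine ⟨fun B hB => ?_, fun n C B hC hB => ?_, htr⟩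
  · exact (Measure.map_apply hx hB).symm.trans (congrArg (fun m : Measure X => m B) h0)
  · rw [hact n C B hC hB]
    refine lintegral_congr_ae (ae_restrict_of_ae ?_)
    have h1 : ∀ᵐ y ∂(p : Measure (Traj X A)).map (fun ω => (ω 0).1), y = x := by
      rw [h0]
      exact (ae_dirac_iff (measurableSet_singleton x)).2 rfl
    filter_upwards [hadm n, ae_of_ae_map hx.aemeasurable h1] with ω hω hω0
    rw [hπ n _ ((first_histAt n ω).trans hω0) hω]

/-- The description of the strategic measures by conditional distributions. -/
theorem feasible_eq (hW : MeasurableSet W) (hdirac : ∀ a, diracProba a ∈ W) :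
    T.feasible M W = withInitialState (strategicSet (T.policies M W)) := by
  ext ⟨x, p⟩
  constructor
  · intro hp
    obtain ⟨k, hk, hkadm, hkcond⟩ := T.exists_admissible_version M hW hdirac
    have hν : UnivMeasurable fun s => k (p, s) := hk.comp measurable_prodMk_left.univMeasurable
    let π : Policy M :=
      { kernel := fun n h => k (p, T.key n h)
        univ_kernel := fun n =>
          isUnivKernel_iff.2 (hν.comp (T.measurable_key n).univMeasurable)
        constraint := fun n h => by
          have := (hkadm p (T.key n h)).2
          rwa [T.state_key] at this }
    exact ⟨⟨π, ⟨⟨_, hν, fun n h => rfl⟩, fun n h => (hkadm p (T.key n h)).1⟩, diracProba x,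
      strategicMeasure_eq_iff.2 (T.isInducedBy_of_mem_feasible hp fun n h _ hh =>
        hkcond p _ hh)⟩, hp.1⟩
  · rintro ⟨⟨π, hπ, p₀, hp⟩, h0⟩
    have hind : IsInducedBy π p₀ p := strategicMeasure_eq_iff.1 hp
    have hc := T.cond_ae_eq_kernel hπ hind
    refine ⟨h0, hind.transition, fun n C B hC hB => ?_, fun n => ?_⟩
    · refine (hind.action n C B hC hB).trans (lintegral_congr_ae (ae_restrict_of_ae ?_))
      filter_upwards [hc n] with ω hω
      rw [hω]
    · filter_upwards [hc n] with ω hω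
      have : kernelToProb T.cond (p, T.key n (histAt n ω)) = π.kernel n (histAt n ω) :=
        Subtype.ext hω
      rw [this]
      exact ⟨hπ.2 n _, by rw [T.state_key]; exact π.constraint n _⟩

/-- Measurably selected strategic measures for the different initial states are generated by a
single policy, which in addition uses the initial state. -/
theorem exists_policy_of_selector (hW : MeasurableSet W) (hdirac : ∀ a, diracProba a ∈ W)
    {ζ : X → ProbabilityMeasure (Traj X A)} (hζ : UnivMeasurable ζ)
    (hmem : ∀ x, (x, ζ x) ∈ T.feasible M W) :
    ∃ π : Policy M, (∃ ν : X × S → ProbabilityMeasure A, UnivMeasurable ν ∧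
      ∀ n h, π.kernel n h = ν (Hist.first h, T.key n h)) ∧ (∀ n h, π.kernel n h ∈ W) ∧
      ∀ x, strategicMeasure (diracProba x) π = ζ x := by
  obtain ⟨k, hk, hkadm, hkcond⟩ := T.exists_admissible_version M hW hdirac
  -- The initial state tells the policy which of the selected measures to follow.
  have hν : UnivMeasurable fun w : X × S => k (ζ w.1, w.2) :=
    hk.comp ((hζ.comp measurable_fst.univMeasurable).prodMk measurable_snd.univMeasurable)
  let π : Policy M :=
    { kernel := fun n h => k (ζ h.first, T.key n h)
      univ_kernel := fun n => isUnivKernel_iff.2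
        (hν.comp ((measurable_first n).prodMk (T.measurable_key n)).univMeasurable)
      constraint := fun n h => by
        have := (hkadm (ζ h.first) (T.key n h)).2
        rwa [T.state_key] at this }
  refine ⟨π, ⟨_, hν, fun n h => rfl⟩, fun n h => (hkadm _ (T.key n h)).1, fun x => ?_⟩
  refine (strategicMeasure_eq_iff.2 (T.isInducedBy_of_mem_feasible (hmem x)
    fun n h hx hh => ?_)).symm
  subst hx
  exact hkcond _ _ hh

/-- Always playing a selected action at the current state is possible whatever the statistic,
because the statistic determines the state. Selection needs these nonempty sections. -/
lemma exists_mem_feasible (hW : MeasurableSet W) (hdirac : ∀ a, diracProba a ∈ W) (x : X) :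
    ∃ p, (x, p) ∈ T.feasible M W := by
  obtain ⟨α, hα, hαM⟩ := M.adm_analytic.exists_univMeasurable_selection
  have hν : UnivMeasurable fun s => diracProba (α (T.state s)) :=
    measurable_diracProba.univMeasurable.comp (hα.comp T.measurable_state.univMeasurable)
  let π : Policy M :=
    { kernel := fun n h => diracProba (α (T.state (T.key n h)))
      univ_kernel := fun n => isUnivKernel_iff.2 (hν.comp (T.measurable_key n).univMeasurable)
      constraint := fun n h => by
        obtain ⟨a, ha⟩ := M.adm_nonempty h.last
        rw [T.state_key]
        exact Measure.dirac_apply_of_mem (hαM _ a ha) }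
  refine ⟨strategicMeasure (diracProba x) π, ?_⟩
  rw [T.feasible_eq hW hdirac]
  refine ⟨⟨π, ⟨⟨_, hν, fun n h => rfl⟩, fun n h => hdirac _⟩, _, rfl⟩, ?_⟩
  have hx : Measurable fun ω : Traj X A => (ω 0).1 := by fun_prop
  have hind : IsInducedBy π (diracProba x) _ := strategicMeasure_eq_iff.1 rfl
  ext B hB
  rw [Measure.map_apply hx hB]
  exact hind.initial B hB

end Statistic

end UMDP

namespace UMDP

/-! ### Integrals of extended-real functions -/

section ExtIntegral

variable {T : Type*} [MeasurableSpace T] {μ : Measure T} [IsProbabilityMeasure μ] {f : T → EReal}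

/-- Positive and negative parts are compared separately with those of the constant. Monotonicity of
`lintegral` requires no measurability. -/
lemma le_extIntegral {b : EReal} (h : ∀ t, b ≤ f t) : b ≤ extIntegral μ f := by
  unfold extIntegral
  split_ifs with htop
  · exact le_top
  induction b using EReal.rec with
  | bot => exact bot_le
  | top =>
    have : ∀ t, f t = ⊤ := fun t => top_le_iff.1 (h t)
    simp [this] at htop
  | coe r =>
    have h1 : ENNReal.ofReal r ≤ ∫⁻ t, (f t).toENNReal ∂μ := by
      calc ENNReal.ofReal r = ∫⁻ _, ENNReal.ofReal r ∂μ := by simp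
        _ ≤ _ := lintegral_mono fun t => by
          simpa using EReal.toENNReal_le_toENNReal (h t)
    have h2 : ∫⁻ t, (-f t).toENNReal ∂μ ≤ ENNReal.ofReal (-r) := by
      calc ∫⁻ t, (-f t).toENNReal ∂μ ≤ ∫⁻ _, ENNReal.ofReal (-r) ∂μ := lintegral_mono fun t => by
            simpa [← EReal.coe_neg] using
              EReal.toENNReal_le_toENNReal (EReal.neg_le_neg_iff.2 (h t))
        _ = _ := by simp
    refine le_trans ?_ (EReal.sub_le_sub (EReal.coe_ennreal_le_coe_ennreal_iff.2 h1)
      (EReal.coe_ennreal_le_coe_ennreal_iff.2 h2))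
    rw [EReal.coe_ennreal_ofReal, EReal.coe_ennreal_ofReal, ← EReal.coe_sub,
      EReal.coe_le_coe_iff]
    rcases le_total 0 r with hr | hr <;> simp [hr]

/-- A function above `r` at every point would have integral strictly above `r`. Strict monotonicity
of the integral is where measurability enters. -/
lemma exists_le_of_extIntegral_le (hf : AEMeasurable f μ) {r : ℝ}
    (h : extIntegral μ f ≤ (r : EReal)) : ∃ t, f t ≤ (r : EReal) := by
  by_contra! hlt
  unfold extIntegral at h
  split_ifs at h with htop
  · exact (EReal.coe_ne_top r) (top_le_iff.1 h)
  have h2 : ∫⁻ t, (-f t).toENNReal ∂μ ≤ ENNReal.ofReal (-r) := by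
    calc ∫⁻ t, (-f t).toENNReal ∂μ ≤ ∫⁻ _, ENNReal.ofReal (-r) ∂μ := lintegral_mono fun t => by
          simpa [← EReal.coe_neg] using
            EReal.toENNReal_le_toENNReal (EReal.neg_le_neg_iff.2 (hlt t).le)
      _ = _ := by simp
  have hb : ∫⁻ t, (-f t).toENNReal ∂μ ≠ ⊤ := ne_top_of_le_ne_top ENNReal.ofReal_ne_top h2
  -- The inequality `r < f t` with negative parts moved across, so that it can be integrated in
  -- `ℝ≥0∞` without subtraction.
  have hpt : ∀ t, (-f t).toENNReal + ENNReal.ofReal r < (f t).toENNReal + ENNReal.ofReal (-r) := by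
    intro t
    have ht := hlt t
    generalize f t = s at ht ⊢
    induction s using EReal.rec with
    | bot => exact absurd ht not_lt_bot
    | top => simp
    | coe s =>
      have hs : r < s := EReal.coe_lt_coe_iff.1 ht
      rw [← EReal.coe_neg, EReal.toENNReal_of_ne_top (EReal.coe_ne_top _),
        EReal.toENNReal_of_ne_top (EReal.coe_ne_top _), EReal.toReal_coe, EReal.toReal_coe,
        ENNReal.ofReal, ENNReal.ofReal, ENNReal.ofReal, ENNReal.ofReal]
      norm_cast
      rw [← NNReal.coe_lt_coe]
      simp only [NNReal.coe_add, Real.coe_toNNReal']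
      rcases le_total 0 r with h1 | h1 <;> rcases le_total 0 s with h2 | h2 <;> simp [h1, h2] <;>
        linarith
  have hm : AEMeasurable (fun t => (f t).toENNReal + ENNReal.ofReal (-r)) μ :=
    (measurable_ereal_toENNReal.comp_aemeasurable hf).add aemeasurable_const
  have hstrict := lintegral_strict_mono (IsProbabilityMeasure.ne_zero μ) hm
    (f := fun t => (-f t).toENNReal + ENNReal.ofReal r) (by
      rw [lintegral_add_right _ measurable_const]
      simpa using hb) (Filter.Eventually.of_forall hpt)
  rw [lintegral_add_right _ measurable_const, lintegral_add_right _ measurable_const] at hstrict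
  simp only [lintegral_const, measure_univ, mul_one] at hstrict
  lift ∫⁻ t, (f t).toENNReal ∂μ to NNReal using htop with a
  lift ∫⁻ t, (-f t).toENNReal ∂μ to NNReal using hb with b
  have h3 : (a : ℝ) - b ≤ r := by
    rw [← EReal.coe_le_coe_iff]; exact h
  rw [ENNReal.ofReal, ENNReal.ofReal] at hstrict
  norm_cast at hstrict
  rw [← NNReal.coe_lt_coe] at hstrict
  simp only [NNReal.coe_add, Real.coe_toNNReal'] at hstrict
  rcases le_total 0 r with h1 | h1 <;> simp [h1] at hstrict <;> linarith

end ExtIntegral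

/-! ### The three policy classes -/

variable {X A : Type*} [MeasurableSpace X] [MeasurableSpace A]

/-- The statistic on which the policies generating the strategic measures act: the padded history
with its length, the state with the stage, and the state, respectively. -/
def PolicyClass.statistic (c : PolicyClass) (a₀ : A) : Statistic X A (ℕ × Traj X A) where
  key := match c with
    | general => fun n h => (n, fun i => if hi : i < n then h.1 ⟨i, hi⟩ else (h.2, a₀))
    | markov => fun n h => (n, fun _ => (h.2, a₀))
    | stationary => fun _ h => (0, fun _ => (h.2, a₀))
  measurable_key := by
    rcases c with _ | _ | _
    · refine fun n => measurable_const.prodMk (measurable_pi_lambda _ fun i => ?_)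
      by_cases hi : i < n
      · simp only [hi, dite_true]; fun_prop
      · simp only [hi, dite_false]; fun_prop
    all_goals intro n; dsimp only; fun_prop
  -- In the general case the padding starts at index `n`, which therefore carries the current state.
  -- In the other two cases the recorded trajectory is constant and any index would do.
  state := fun s => (s.2 s.1).1
  measurable_state := measurable_from_prod_countable_right fun n => by dsimp only; fun_prop
  state_key := by
    rcases c with _ | _ | _ <;> intro n h <;> simp [Hist.last]

lemma univMeasurable_kernel_histAt (M : MDP X A) (π : Policy M) :
    UnivMeasurable fun s : ℕ × Traj X A => π.kernel s.1 (histAt s.1 s.2) :=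
  univMeasurable_from_prod_countable fun n =>
    (isUnivKernel_iff.1 (π.univ_kernel n)).comp (measurable_histAt n).univMeasurable

lemma PolicyClass.policies_statistic (c : PolicyClass) (a₀ : A) (M : MDP X A)
    (W : Set (ProbabilityMeasure A)) :
    (c.statistic a₀).policies M W = c.generators M ∩ {π | ∀ n h, π.kernel n h ∈ W} := by
  ext π
  refine and_congr_left fun _ => ?_
  rcases c with _ | _ | _
  · refine iff_of_true ⟨_, univMeasurable_kernel_histAt M π, fun n h => ?_⟩ trivial
    congr 1
    refine Prod.ext (funext fun i => ?_) ?_ <;> simp [statistic, histAt]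
  · constructor
    · rintro ⟨ν, -, hν⟩ n
      exact ⟨fun x => ν (n, fun _ => (x, a₀)), hν n⟩
    -- The function witnessing the Markov property carries no measurability. Evaluating the policy
    -- itself on constant histories supplies a universally measurable replacement.
    · intro hπ
      refine ⟨_, univMeasurable_kernel_histAt M π, fun n h => ?_⟩
      obtain ⟨ν, hν⟩ := hπ n
      exact (hν h).trans (hν (histAt n fun _ => (h.2, a₀))).symm
  · constructor
    · rintro ⟨ν, hν, h⟩
      have hm : Measurable fun x : X => ((0 : ℕ), fun _ : ℕ => (x, a₀)) := by fun_prop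
      exact ⟨fun x => ν (0, fun _ => (x, a₀)),
        isUnivKernel_iff.2 (hν.comp hm.univMeasurable), h⟩
    · rintro ⟨ν, hν, h⟩
      have hm : Measurable fun s : ℕ × Traj X A => (s.2 0).1 := by fun_prop
      exact ⟨fun s => ν (s.2 0).1, (isUnivKernel_iff.1 hν).comp hm.univMeasurable, h⟩

lemma PolicyClass.mem_policies_of_statistic (c : PolicyClass) (a₀ : A) {M : MDP X A}
    {π : Policy M} {ν : X × (ℕ × Traj X A) → ProbabilityMeasure A} (hν : UnivMeasurable ν)
    (h : ∀ n h, π.kernel n h = ν (Hist.first h, (c.statistic a₀).key n h)) :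
    π ∈ c.policies M := by
  rcases c with _ | _ | _
  · trivial
  · exact fun n => ⟨fun w => ν (w.1, n, fun _ => (w.2, a₀)), h n⟩
  · have hm : Measurable fun w : X × X => (w.1, (0 : ℕ), fun _ : ℕ => (w.2, a₀)) := by fun_prop
    exact ⟨fun w => ν (w.1, 0, fun _ => (w.2, a₀)),
      isUnivKernel_iff.2 (hν.comp hm.univMeasurable), h⟩

/-! ### Analyticity of the sets of strategic measures, and optimal policies -/

section Graph

variable [StandardBorelSpace A]

/-- The initial states and strategic measures of the generating policies with action distributions
in `W`. -/
def PolicyClass.graphWithin (c : PolicyClass) (M : MDP X A) (W : Set (ProbabilityMeasure A)) :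
    Set (X × ProbabilityMeasure (Traj X A)) :=
  withInitialState (strategicSet (c.generators M ∩ {π | ∀ n h, π.kernel n h ∈ W}))

lemma PolicyClass.graphWithin_univ (c : PolicyClass) (M : MDP X A) :
    c.graphWithin M univ = c.graph M := by
  simp [graphWithin, graph]

lemma PolicyClass.graphWithin_range_diracProba (c : PolicyClass) (M : MDP X A) :
    c.graphWithin M (range diracProba) = c.graphNonrand M := by
  simp only [graphWithin, graphNonrand, Policy.IsNonrandomized, mem_range, eq_comm]

lemma PolicyClass.graphNonrand_subset (c : PolicyClass) (M : MDP X A) :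
    c.graphNonrand M ⊆ c.graph M := by
  rintro z ⟨⟨π, hπ, h⟩, h0⟩
  exact ⟨⟨π, hπ.1, h⟩, h0⟩

lemma map_initial_strategicMeasure {M : MDP X A} (p₀ : ProbabilityMeasure X) (π : Policy M) :
    (strategicMeasure p₀ π : Measure (Traj X A)).map (fun ω => (ω 0).1) = p₀ := by
  have hx : Measurable fun ω : Traj X A => (ω 0).1 := by fun_prop
  ext B hB
  rw [Measure.map_apply hx hB]
  exact (strategicMeasure_eq_iff.1 rfl : IsInducedBy π p₀ _).initial B hB

variable [StandardBorelSpace X] [Nonempty A] (c : PolicyClass) (M : MDP X A) {W : Set (ProbabilityMeasure A)}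

lemma PolicyClass.feasible_statistic (a₀ : A) (hW : MeasurableSet W)
    (hdirac : ∀ a, diracProba a ∈ W) :
    (c.statistic a₀).feasible M W = c.graphWithin M W := by
  rw [(c.statistic a₀).feasible_eq hW hdirac, policies_statistic, graphWithin]

lemma PolicyClass.isAnalytic_graphWithin (hW : MeasurableSet W)
    (hdirac : ∀ a, diracProba a ∈ W) : IsAnalytic (c.graphWithin M W) := by
  obtain ⟨a₀⟩ := ‹Nonempty A›
  rw [← c.feasible_statistic M a₀ hW hdirac]
  exact (c.statistic a₀).isAnalytic_feasible M hW

/-- Optimal policies with action distributions in `W`. -/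
theorem PolicyClass.exists_isEpsOptimal (hW : MeasurableSet W) (hdirac : ∀ a, diracProba a ∈ W)
    {φ : X × ProbabilityMeasure (Traj X A) → EReal}
    (hφ : HasAnalyticSublevels (c.graphWithin M W) φ) {ε : ℝ} (hε : 0 < ε) :
    ∃ π ∈ c.policies M, (∀ n h, π.kernel n h ∈ W) ∧
      (∀ x, (x, strategicMeasure (diracProba x) π) ∈ c.graphWithin M W) ∧
      IsEpsOptimal φ (partialInf (c.graphWithin M W) φ) (minimizerSet (c.graphWithin M W) φ) ε
        fun x => strategicMeasure (diracProba x) π := by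
  obtain ⟨a₀⟩ := id ‹Nonempty A›
  have hD := c.isAnalytic_graphWithin M hW hdirac
  have hfeas := c.feasible_statistic M a₀ hW hdirac
  obtain ⟨ζ, hζ, hmem, hopt⟩ := exists_univMeasurable_isEpsOptimal ⟨hD, hφ⟩
    (hfeas ▸ (c.statistic a₀).exists_mem_feasible hW hdirac) hε
  obtain ⟨π, ⟨ν, hν, h⟩, hπW, hπ⟩ :=
    (c.statistic a₀).exists_policy_of_selector hW hdirac hζ (hfeas ▸ hmem)
  have hfun : (fun x => strategicMeasure (diracProba x) π) = ζ := funext hπ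
  exact ⟨π, c.mem_policies_of_statistic a₀ hν h, hπW, fun x => (hπ x).symm ▸ hmem x,
    hfun ▸ hopt⟩

end Graph

/-- Serves the degenerate case of an empty action space, which forces the state space to be empty
and for which the conditional kernels on `A` are not defined. -/
lemma PolicyClass.exists_policy_of_isEmpty [IsEmpty X] (c : PolicyClass) (M : MDP X A) :
    ∃ π ∈ c.policies M, π.IsNonrandomized := by
  have hH : ∀ n, IsEmpty (Hist X A n) := fun n => inferInstanceAs (IsEmpty ((Fin n → X × A) × X))
  let π : Policy M := ⟨fun n h => ((hH n).false h).elim, fun n B _ s _ => by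
    rw [eq_empty_of_isEmpty ((fun h : Hist X A n => _) ⁻¹' s)]
    exact @MeasurableSet.empty _ (universalSigma _), fun n h => ((hH n).false h).elim⟩
  have : ∀ ν : X × X → ProbabilityMeasure A, IsUnivKernel ν := fun ν B _ s _ => by
    rw [eq_empty_of_isEmpty ((fun x => (ν x : Measure A) B) ⁻¹' s)]
    exact @MeasurableSet.empty _ (universalSigma _)
  refine ⟨π, ?_, fun n h => ((hH n).false h).elim⟩
  rcases c with _ | _ | _
  · trivial
  · exact fun n => ⟨isEmptyElim, fun h => ((hH n).false h).elim⟩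
  · exact ⟨isEmptyElim, this _, fun n h => ((hH n).false h).elim⟩

/-! ### The sufficient condition by mixtures -/

instance : IsProbabilityMeasure lebesgueProd := by unfold lebesgueProd; infer_instance

section Mixture

variable [StandardBorelSpace A] {c : PolicyClass} {M : MDP X A}
  {φ : X × ProbabilityMeasure (Traj X A) → EReal}

/-- A mixture representation passes the Markov property on to its components but makes no claim
about stationarity, hence the restriction on `c`. -/
lemma PolicyClass.mem_graphNonrand_of_isMixtureOf (hc : c ≠ stationary) {π : Policy M}
    (hπ : π ∈ c.generators M) {f : (ℕ → unitInterval) → Policy M} (hf : IsMixtureOf π f)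
    (θ : ℕ → unitInterval) (x : X) :
    (x, strategicMeasure (diracProba x) (f θ)) ∈ c.graphNonrand M := by
  refine ⟨⟨f θ, ⟨?_, hf.nonrandomized θ⟩, _, rfl⟩, map_initial_strategicMeasure _ _⟩
  rcases c with _ | _ | _
  · trivial
  · exact hf.markov hπ θ
  · exact absurd rfl hc

lemma PolicyClass.exists_generator_of_mem_graph {x : X} {p : ProbabilityMeasure (Traj X A)}
    (h : (x, p) ∈ c.graph M) : ∃ π ∈ c.generators M, p = strategicMeasure (diracProba x) π := by
  obtain ⟨⟨π, hπ, p₀, rfl⟩, h0⟩ := h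
  have : p₀ = diracProba x := Subtype.ext ((map_initial_strategicMeasure p₀ π).symm.trans h0)
  exact ⟨π, hπ, by rw [this]⟩

/-- The sublevel sets of `φ` are controlled only inside the graph, and every component of the
mixture stays there. Universally measurable preimages of analytic sets are universally measurable.
-/
lemma IsMixtureOf.aemeasurable_cost [StandardBorelSpace X] (hφ : HasAnalyticSublevels (c.graph M) φ)
    (hc : c ≠ .stationary) {π : Policy M} (hπ : π ∈ c.generators M)
    {f : (ℕ → unitInterval) → Policy M} (hf : IsMixtureOf π f) (x : X) :
    AEMeasurable (fun θ => φ (x, strategicMeasure (diracProba x) (f θ))) lebesgueProd := by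
  have hpair : Measurable fun θ : ℕ → unitInterval => (diracProba x, θ) := by fun_prop
  have hm : UnivMeasurable fun θ => (x, strategicMeasure (diracProba x) (f θ)) :=
    measurable_const.univMeasurable.prodMk (hf.univ_measurable.comp hpair.univMeasurable)
  have hu : UnivMeasurable fun θ => φ (x, strategicMeasure (diracProba x) (f θ)) := by
    refine univMeasurable_of_sublevels fun r => ?_
    convert hm.measurable_universalSigma (hφ r).measurableSet_universalSigma using 1
    ext θ
    exact ⟨fun h => ⟨c.graphNonrand_subset M (PolicyClass.mem_graphNonrand_of_isMixtureOf
      hc hπ hf θ x), h⟩, fun h => h.2⟩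
  exact (hu.nullMeasurable lebesgueProd).aemeasurable

end Mixture

end UMDP

/-! ### Assembly of the theorem -/

theorem theorem3p3 {X A : Type*} [MeasurableSpace X] [StandardBorelSpace X]
    [MeasurableSpace A] [StandardBorelSpace A] (M : UMDP.MDP X A) (c : UMDP.PolicyClass)
    (φ : X × ProbabilityMeasure (UMDP.Traj X A) → EReal)
    (hφ : UMDP.HasAnalyticSublevels (c.graph M) φ) :
    -- (i)
    UMDP.LowerSemianalyticOn univ (UMDP.partialInf (c.graph M) φ) ∧
    -- (ii)
    (∀ ε : ℝ, 0 < ε → ∃ π ∈ c.policies M,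
      (∀ x, (x, UMDP.strategicMeasure (diracProba x) π) ∈ c.graph M) ∧
      UMDP.IsEpsOptimal φ (UMDP.partialInf (c.graph M) φ) (UMDP.minimizerSet (c.graph M) φ) ε
        fun x => UMDP.strategicMeasure (diracProba x) π) ∧
    -- (iii), nonrandomized policies
    ((∀ x, UMDP.partialInf (c.graph M) φ x = UMDP.partialInf (c.graphNonrand M) φ x) →
      ∀ ε : ℝ, 0 < ε → ∃ π ∈ c.policies M, π.IsNonrandomized ∧
        (∀ x, (x, UMDP.strategicMeasure (diracProba x) π) ∈ c.graphNonrand M) ∧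
        UMDP.IsEpsOptimal φ (UMDP.partialInf (c.graph M) φ)
          (UMDP.minimizerSet (c.graphNonrand M) φ) ε
          fun x => UMDP.strategicMeasure (diracProba x) π) ∧
    -- (iii), the sufficient condition
    (c ≠ UMDP.PolicyClass.stationary →
      (∀ π ∈ c.generators M, ∃ f : (ℕ → unitInterval) → UMDP.Policy M, UMDP.IsMixtureOf π f ∧
        ∀ x, UMDP.extIntegral UMDP.lebesgueProd
            (fun θ => φ (x, UMDP.strategicMeasure (diracProba x) (f θ))) ≤
          φ (x, UMDP.strategicMeasure (diracProba x) π)) →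
      (∀ x, UMDP.partialInf (c.graph M) φ x = UMDP.partialInf (c.graphNonrand M) φ x) ∧
      ∀ x ∈ UMDP.minimizerSet (c.graph M) φ, UMDP.partialInf (c.graph M) φ x ≠ ⊥ →
        x ∈ UMDP.minimizerSet (c.graphNonrand M) φ) := by
  have hsub := c.graphNonrand_subset M
  have hle : ∀ x, UMDP.partialInf (c.graph M) φ x ≤ UMDP.partialInf (c.graphNonrand M) φ x :=
    fun x => le_iInf₂ fun p hp => iInf₂_le p (hsub hp)
  refine ⟨UMDP.LowerSemianalyticOn.partialInf hφ, ?_⟩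
  rcases isEmpty_or_nonempty A with hA | hA
  · have hX : IsEmpty X := ⟨fun x => hA.false (M.adm_nonempty x).some⟩
    obtain ⟨π, hπ, hπn⟩ := c.exists_policy_of_isEmpty M
    exact ⟨fun ε _ => ⟨π, hπ, isEmptyElim, isEmptyElim, isEmptyElim⟩,
      fun _ ε _ => ⟨π, hπ, hπn, isEmptyElim, isEmptyElim, isEmptyElim⟩,
      fun _ _ => ⟨isEmptyElim, isEmptyElim⟩⟩
  refine ⟨fun ε hε => ?_, fun heq ε hε => ?_, fun hc hmix => ?_⟩
  · obtain ⟨π, hπ, -, h⟩ := c.exists_isEpsOptimal M MeasurableSet.univ (fun _ => trivial)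
      (φ := φ) (by rwa [c.graphWithin_univ]) hε
    rw [c.graphWithin_univ] at h
    exact ⟨π, hπ, h⟩
  · have hW := UMDP.measurableSet_range_diracProba (Y := A)
    have hD := c.isAnalytic_graphWithin M hW mem_range_self
    rw [c.graphWithin_range_diracProba] at hD
    obtain ⟨π, hπ, hπW, h⟩ := c.exists_isEpsOptimal M hW mem_range_self
      -- The nonrandomized graph is itself analytic, so restricting `φ` to it keeps the sublevel
      -- sets analytic.
      (φ := φ) (by rw [c.graphWithin_range_diracProba]; exact hφ.mono hD hsub) hε
    rw [c.graphWithin_range_diracProba] at h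
    rw [show UMDP.partialInf (c.graph M) φ = _ from funext heq]
    exact ⟨π, hπ, fun n h => (hπW n h).imp fun _ => Eq.symm, h⟩
  · refine ⟨fun x => (hle x).antisymm (le_iInf₂ fun p hp => ?_), fun x hx hbot => ?_⟩
    · obtain ⟨π, hπ, rfl⟩ := UMDP.PolicyClass.exists_generator_of_mem_graph hp
      obtain ⟨f, hf, hfx⟩ := hmix π hπ
      refine (UMDP.le_extIntegral fun θ => ?_).trans (hfx x)
      exact iInf₂_le (f := fun p (_ : (x, p) ∈ c.graphNonrand M) => φ (x, p)) _
        (UMDP.PolicyClass.mem_graphNonrand_of_isMixtureOf hc hπ hf θ x)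
    · obtain ⟨p, hp, hpx⟩ := UMDP.mem_minimizerSet_iff.1 hx
      obtain ⟨π, hπ, rfl⟩ := UMDP.PolicyClass.exists_generator_of_mem_graph hp
      obtain ⟨f, hf, hfx⟩ := hmix π hπ
      have hmem := UMDP.PolicyClass.mem_graphNonrand_of_isMixtureOf hc hπ hf (x := x)
      -- A component reaching the infimum over all policies also minimizes among the nonrandomized
      -- ones, whose infimum is no smaller.
      suffices ∃ θ, φ (x, UMDP.strategicMeasure (diracProba x) (f θ)) ≤
          UMDP.partialInf (c.graph M) φ x by
        obtain ⟨θ, hθ⟩ := this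
        exact UMDP.mem_minimizerSet_iff.2 ⟨_, hmem θ, hθ.trans (hle x)⟩
      have hint := (hfx x).trans hpx
      -- For the value `⊤` any component will do; otherwise the value is real and bounds the average
      -- of the costs.
      rcases eq_or_ne (UMDP.partialInf (c.graph M) φ x) ⊤ with htop | htop
      · exact ⟨fun _ => 0, htop ▸ le_top⟩
      lift UMDP.partialInf (c.graph M) φ x to ℝ using ⟨htop, hbot⟩ with r
      exact UMDP.exists_le_of_extIntegral_le (hf.aemeasurable_cost hφ hc hπ x) hint
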